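/- **Definitions.** Links are unoriented links in $S^3$. *Two-fold marking data* for a link $L$ is a function $\omega$ from the components of $L$ to $\mathbb{Z}/2$ with $\sum_K\omega(K)=0$; the pair $(L,\omega)$ is a *two-fold marked link*. If instead $\sum_K\omega(K)=1$, then $(L,\omega)$ is an *odd-marked link*. A *dotted diagram* of $(L,\omega)$ is a diagram $D$ of $L$ with finitely many dots on its arcs (away from the crossings), such that for each component $K$ the number of dots on $K$ is congruent to $\omega(K)$ mod $2$. Smoothing a crossing of a dotted diagram in either of the two ways, keeping the dots, gives dotted diagrams of two two-fold marked links. Let $\det$ denote the determinant of a link, $\det(L)=|V_L(-1)|$ with $V_L$ the Jones polynomial. The set $\mathcal{Q}_2$ of *two-fold quasi-alternating (TQA)* two-fold marked links is the smallest set of two-fold marked links (up to isotopy) such that: 1. the unknot with its trivial marking is in $\mathcal{Q}_2$; 2. every two-fold marked link that is a split union of two odd-marked links is in $\mathcal{Q}_2$; 3. if $(L,\omega)$ has a dotted diagram with a crossing whose two smoothings represent $(L_0,\omega_0),(L_1,\omega_1)\in\mathcal{Q}_2$ with $\det(L)=\det(L_0)+\det(L_1)$, then $(L,\omega)\in\mathcal{Q}_2$.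 A link $L$ is *TQA* if $(L,0)\in\mathcal{Q}_2$. For $e\in\mathbb{Z}$ and nonzero rationals $t_1,\dots,t_p$, the *Montesinos link* $M(e;t_1,\dots,t_p)$ is obtained by placing the rational tangles $t_1,\dots,t_p$ and $e$ horizontal half-twists side by side in a row, joining neighbouring ends, and joining the two remaining upper ends and the two remaining lower ends. Here the tangle $n\in\mathbb{Z}_{>0}$ is a vertical column of $n$ crossings whose overstrands have positive slope (so that $M(0;p,q,r)$ is the pretzel link $P(p,q,r)$); the tangle $t+1$ arises from $t>0$ by adding one such crossing at the top, the tangle $1/(1/t+1)$ by adding one such crossing at the right, and $-t$ is the mirror image of $t$. **Proposition.** Let $n\ge 1$ and let $s,r_1,\dots,r_n$ be positive rational numbers with $s\ge\min\{r_1,\dots,r_n\}$. Then there is two-fold marking data $\omega$ on the Montesinos link $L=M(0;r_1,\dots,r_n,-s)$ such that $(L,\omega)$ is TQA. In particular, if $L$ is a knot, then $L$ is TQA. -/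

import Mathlib

/-! Links are presented by diagrams in the plane in Morse position, read from bottom to top as a
sequence of elementary pieces, and are considered up to the (Turaev) moves that generate isotopy:
planar isotopies in Morse position and the Reidemeister moves. Two-fold marking data is drawn as
dots on the diagram; dots slide along the components, and two dots on a component cancel. -/

namespace MarkedLinks

/-- The elementary pieces. The strands at a given height are numbered `0, 1, 2, …` from the left,
and `i` is the number of the leftmost strand that takes part in the piece.
* `cup i`: a local minimum, creating the strands `i` and `i + 1`;
* `cap i`: a local maximum, joining the strands `i` and `i + 1`;
* `cross i b`: the strands `i` and `i + 1` cross; the strand coming from the lower left passes over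
  the other one if `b = true`, and under it if `b = false`;
* `dot i`: a dot on the strand `i`. -/
inductive Piece : Type
  | cup (i : ℕ)
  | cap (i : ℕ)
  | cross (i : ℕ) (b : Bool)
  | dot (i : ℕ)
  deriving DecidableEq

namespace Piece

/-- The number of the leftmost strand that takes part. -/
def pos : Piece → ℕ
  | cup i => i
  | cap i => i
  | cross i _ => i
  | dot i => i

/-- The number of strands entering the piece from below. -/
def ins : Piece → ℕ
  | cup _ => 0
  | cap _ => 2
  | cross _ _ => 2
  | dot _ => 1

/-- The number of strands leaving the piece at the top. -/
def outs : Piece → ℕ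
  | cup _ => 2
  | cap _ => 0
  | cross _ _ => 2
  | dot _ => 1

/-- The same piece at the position `j`. -/
def moveTo (j : ℕ) : Piece → Piece
  | cup _ => cup j
  | cap _ => cap j
  | cross _ b => cross j b
  | dot _ => dot j

/-- The piece moved to the right by `d` strands. -/
def shift (d : ℕ) (e : Piece) : Piece := e.moveTo (e.pos + d)

/-- Whether the piece is a dot. -/
def isDot : Piece → Bool
  | dot _ => true
  | _ => false

end Piece

open Piece

/-- A sequence of pieces, read from bottom to top. -/
abbrev Word : Type := List Piece

/-- `w` is a (dotted) tangle diagram with `n` ends at the bottom and `m` ends at the top. -/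
def IsTangle : Word → ℕ → ℕ → Prop
  | [], n, m => n = m
  | e :: w, n, m => e.pos + e.ins ≤ n ∧ IsTangle w (n - e.ins + e.outs) m

/-- `w` is a (dotted) link diagram. -/
def IsDiagram (w : Word) : Prop := IsTangle w 0 0

/-- The number of dots. -/
def numDots (w : Word) : ℕ := w.countP isDot

/-- The diagram with all dots erased: the diagram of the underlying link. -/
def eraseDots (w : Word) : Word := w.filter (fun e => !e.isDot)

/-! ### Isotopy of links with dots -/

/-- The local moves. -/
inductive Move : Word → Word → Prop
  /-- Two pieces, `h` lying to the left of `g`, exchange their heights. -/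
  | exchange (g h : Piece) (hgh : h.pos + h.ins ≤ g.pos) :
      Move [g, h] [h, g.moveTo (g.pos - h.ins + h.outs)]
  /-- Cancelling a maximum with an adjacent minimum. -/
  | zigzagLeft (i : ℕ) : Move [cup i, cap (i + 1)] []
  | zigzagRight (i : ℕ) : Move [cup (i + 1), cap i] []
  /-- A strand crossing an arc is moved from one side of its maximum (minimum) to the other. -/
  | pivotCap (i : ℕ) (b : Bool) : Move [cross i b, cap (i + 1)] [cross (i + 1) (!b), cap i]
  | pivotCup (i : ℕ) (b : Bool) : Move [cup (i + 1), cross i b] [cup i, cross (i + 1) (!b)]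
  /-- The first Reidemeister move. -/
  | reidemeisterOneCap (i : ℕ) (b : Bool) : Move [cross i b, cap i] [cap i]
  | reidemeisterOneCup (i : ℕ) (b : Bool) : Move [cup i, cross i b] [cup i]
  /-- The second Reidemeister move. -/
  | reidemeisterTwo (i : ℕ) (b : Bool) : Move [cross i b, cross i (!b)] []
  /-- The third Reidemeister move. The condition says that the three strands are not
  cyclically above one another. -/
  | reidemeisterThree (i : ℕ) (b c d : Bool) (h : c = b ∨ c = d) :
      Move [cross i b, cross (i + 1) c, cross i d]
        [cross (i + 1) d, cross i c, cross (i + 1) b]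
  /-- Dots slide along the strands, also through crossings. -/
  | dotCrossLeft (i : ℕ) (b : Bool) : Move [dot i, cross i b] [cross i b, dot (i + 1)]
  | dotCrossRight (i : ℕ) (b : Bool) : Move [dot (i + 1), cross i b] [cross i b, dot i]
  | dotCup (i : ℕ) : Move [cup i, dot i] [cup i, dot (i + 1)]
  | dotCap (i : ℕ) : Move [dot i, cap i] [dot (i + 1), cap i]
  /-- Two dots on the same strand cancel. -/
  | dotDot (i : ℕ) : Move [dot i, dot i] []

/-- A local move applied inside a link diagram. -/
inductive Step : Word → Word → Prop
  | mk (u v l r : Word) (hm : Move l r) (hl : IsDiagram (u ++ l ++ v))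
      (hr : IsDiagram (u ++ r ++ v)) : Step (u ++ l ++ v) (u ++ r ++ v)

/-- Two dotted diagrams represent the same marked link. -/
def Isotopic : Word → Word → Prop := Relation.EqvGen Step

/-! ### Components -/

/-- The number of strands above a sequence of pieces that starts with no strands. -/
def width (w : Word) : ℕ := w.foldl (fun n e => n - e.ins + e.outs) 0

/-- The points of a diagram, one on each strand at each height between two successive pieces:
`(k, i)` is the point on the strand `i` above the first `k` pieces. -/
def Point (w : Word) : Type := {p : ℕ × ℕ // p.1 ≤ w.length ∧ p.2 < width (w.take p.1)}

/-- Two points are joined by a segment of a strand in the `k`-th piece. -/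
inductive Joined (w : Word) : ℕ × ℕ → ℕ × ℕ → Prop
  | left (k : ℕ) (e : Piece) (he : w[k]? = some e) (i : ℕ) (hi : i < e.pos) :
      Joined w (k, i) (k + 1, i)
  | right (k : ℕ) (e : Piece) (he : w[k]? = some e) (i : ℕ) :
      Joined w (k, e.pos + e.ins + i) (k + 1, e.pos + e.outs + i)
  | cup (k i : ℕ) (he : w[k]? = some (cup i)) : Joined w (k + 1, i) (k + 1, i + 1)
  | cap (k i : ℕ) (he : w[k]? = some (cap i)) : Joined w (k, i) (k, i + 1)
  | crossUp (k i : ℕ) (b : Bool) (he : w[k]? = some (cross i b)) :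
      Joined w (k, i) (k + 1, i + 1)
  | crossDown (k i : ℕ) (b : Bool) (he : w[k]? = some (cross i b)) :
      Joined w (k, i + 1) (k + 1, i)
  | dot (k i : ℕ) (he : w[k]? = some (dot i)) : Joined w (k, i) (k + 1, i)

/-- The components of the link represented by a diagram. -/
def Component (w : Word) : Type := Quot (fun p q : Point w => Joined w p.1 q.1)

/-- The number of components. -/
noncomputable def numComponents (w : Word) : ℕ := Nat.card (Component w)

/-- The diagram represents a knot. -/
def IsKnot (w : Word) : Prop := IsDiagram w ∧ numComponents w = 1

/-! ### The determinant -/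

/-- The Kauffman states: all the ways of smoothing every crossing, each with the number of
`A`-smoothings minus the number of `A⁻¹`-smoothings. A crossing `cross i true` has the `A`-smoothing
with two vertical strands, and `cross i false` has the `A`-smoothing with two horizontal arcs. -/
def states : Word → List (ℤ × Word)
  | [] => [(0, [])]
  | cross i b :: w =>
      (states w).map (fun s => (s.1 + (if b then 1 else -1), s.2)) ++
      (states w).map (fun s => (s.1 - (if b then 1 else -1), cap i :: cup i :: s.2))
  | e :: w => (states w).map (fun s => (s.1, e :: s.2))

/-- The Kauffman bracket at `A`, with value `1` on the unknot diagram without crossings. -/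
noncomputable def bracket (A : ℂ) (w : Word) : ℂ :=
  ((states w).map (fun s => A ^ s.1 * (-A ^ 2 - (A ^ 2)⁻¹) ^ (numComponents s.2 - 1))).sum

/-- The determinant `|V(-1)|` of a link, where `V` is the Jones polynomial: for any orientation,
`V(A⁻⁴)` is the bracket at `A` up to a power of `-A³`, and `A⁻⁴ = -1` for `A = exp (iπ/4)`. -/
noncomputable def linkDet (w : Word) : ℝ :=
  ‖bracket (Complex.exp (Complex.I * Real.pi / 4)) w‖

/-! ### Two-fold quasi-alternating links -/

/-- A diagram of a two-fold marked link: the number of dots is even. -/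
def IsTwoFoldMarked (w : Word) : Prop := IsDiagram w ∧ Even (numDots w)

/-- A diagram of an odd-marked link. -/
def IsOddMarked (w : Word) : Prop := IsDiagram w ∧ Odd (numDots w)

/-- The two-fold marked link represented by the dotted diagram is two-fold quasi-alternating.
For a diagram without dots this says that the link (with the trivial marking) is TQA. -/
inductive IsTQA : Word → Prop
  /-- The unknot with the trivial marking. -/
  | unknot : IsTQA [cup 0, cap 0]
  /-- The split union of two odd-marked links. -/
  | split (u v : Word) (hu : IsOddMarked u) (hv : IsOddMarked v) : IsTQA (u ++ v)
  /-- A crossing both of whose smoothings are TQA and add up to the determinant. -/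
  | skein (u v : Word) (i : ℕ) (b : Bool)
      (hw : IsTwoFoldMarked (u ++ [cross i b] ++ v))
      (h₁ : IsTQA (u ++ v))
      (h₂ : IsTQA (u ++ [cap i, cup i] ++ v))
      (hdet : linkDet (u ++ [cross i b] ++ v) =
        linkDet (u ++ v) + linkDet (u ++ [cap i, cup i] ++ v)) :
      IsTQA (u ++ [cross i b] ++ v)
  /-- The property depends only on the marked link, not on its diagram. -/
  | isotopic (w w' : Word) (h : IsTQA w) (hww' : Isotopic w w') : IsTQA w'

/-! ### Montesinos links -/

/-- The horizontal sum of two tangles with two ends at the bottom and two at the top: `S` is placed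
to the right of `T`, and the right ends of `T` are joined to the left ends of `S`. -/
def hsum (T S : Word) : Word := [cup 1] ++ T ++ S.map (shift 2) ++ [cap 1]

/-- The rational tangle `± a / b`, for coprime positive `a` and `b` (`pos = true` for `+`), in the
convention where the tangle `n` is a vertical column of `n` crossings. The tangle `1` is a crossing
whose overstrand has positive slope; `t + 1` arises from `t` by a further crossing on the top, and
`1 / (1 / t + 1)` by a further crossing on the right. The tangle `-t` is the reflection of the
tangle `t` in a vertical line of the plane. -/
def rationalTangleAux (pos : Bool) (a b : ℕ) : Word :=
  if a = 0 ∨ b = 0 then []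
  else if b ≤ a then rationalTangleAux pos (a - b) b ++ [cross 0 pos]
  else if pos then hsum (rationalTangleAux pos a (b - a)) [cross 0 pos]
  else hsum [cross 0 pos] (rationalTangleAux pos a (b - a))
termination_by a + b
decreasing_by all_goals omega

/-- The rational tangle of a rational number. -/
def rationalTangle (t : ℚ) : Word :=
  rationalTangleAux (decide (0 ≤ t)) t.num.natAbs t.den

/-- A row of `|e|` horizontal half twists of the sign of `e`; two horizontal arcs for `e = 0`. -/
def halfTwists (e : ℤ) : Word :=
  (List.replicate e.natAbs [cross 0 (decide (0 ≤ e))]).foldr hsum [cap 0, cup 0]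

/-- The standard diagram of the Montesinos link `M(e; t₁, …, tₚ)`: the rational tangles
`t₁, …, tₚ` and `e` half twists are summed up in a row, then the two upper ends are joined, and so
are the two lower ends. -/
def montesinos (e : ℤ) (t : List ℚ) : Word :=
  [cup 0] ++ (t.map rationalTangle).foldr hsum (halfTwists e) ++ [cap 0]

end MarkedLinks

namespace MarkedLinks
open Piece

/-! ### Tangles -/

/-! At `A = exp (iπ/4)` a circle has value 0 in the Kauffman bracket, so a tangle with four ends
evaluates to `x` times two vertical strands plus `y` times two horizontal arcs, and the bracket of
its closure is `x`. For the rational tangle of number `t` one has `x = iρy` with real slope `ρ =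
1/t`. Slopes add under horizontal sums, hence the determinant of the link is a constant times `|∑
1/rⱼ - 1/s|`, and whether determinants add at a crossing becomes a question about signs of real
slopes: the two terms of the skein relation must have the same argument (`SkeinClosed.plug_cross`).

This gives the central tool `SkeinClosed.plug_tan`: a rational tangle of sign `b` may be put into a
context as soon as two vertical strands and two horizontal arcs may, provided that the ratio of the
two brackets is `i` times a real number of the sign of `b` or zero. The crossings are moved into the
context one at a time.

Choose `i` with `rᵢ ≤ s`. The link made of the tangles `rᵢ` and `-s` alone has slope `1/rᵢ - 1/s ≥
0`. If `rᵢ < s`, it is a two-bridge link, and a Euclidean algorithm that cancels opposite crossings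
shows that it is TQA for every marking (`SkeinClosed.closure_hsum_tan_tan`). If `rᵢ = s`, all
crossings cancel and leave a two-component unlink, which is TQA once each component carries an odd
number of dots (`exists_dots_isTQA`). The remaining tangles are then inserted one by one
(`IsTQA.insert`); each is positive, so the total slope stays nonnegative. Replacing the new tangle
by horizontal arcs gives back the previous link. Replacing it by vertical strands gives a connected
sum of two-bridge links.

The marking of that connected sum is dictated by the dots already present, so it has to be TQA for
every marking. This property, `AllTQA`, is invariant under isotopy because an isotopy of undotted
diagrams can carry dots along: the dots are first slid out of the region where a move takes place
(`Move.lifts`). For a knot an even number of dots cancels, which gives the last claim.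

Brackets are controlled through components, and components through 2-colourings: their number is `2
^ numComponents` and obeys a recursion along the word (`two_pow_numComponents`), so that local
relations can be checked locally. -/

@[simp] theorem shift_cup (d i : ℕ) : shift d (cup i) = cup (i + d) := rfl
@[simp] theorem shift_cap (d i : ℕ) : shift d (cap i) = cap (i + d) := rfl
@[simp] theorem shift_cross (d i : ℕ) (b : Bool) : shift d (cross i b) = cross (i + d) b := rfl
@[simp] theorem shift_dot (d i : ℕ) : shift d (dot i) = dot (i + d) := rfl

@[simp] theorem shift_zero (e : Piece) : shift 0 e = e := by cases e <;> rfl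

theorem shift_shift (d d' : ℕ) (e : Piece) : shift d (shift d' e) = shift (d' + d) e := by
  cases e <;> simp [Nat.add_assoc]

@[simp] theorem pos_shift (d : ℕ) (e : Piece) : (shift d e).pos = e.pos + d := by cases e <;> rfl
@[simp] theorem ins_shift (d : ℕ) (e : Piece) : (shift d e).ins = e.ins := by cases e <;> rfl
@[simp] theorem outs_shift (d : ℕ) (e : Piece) : (shift d e).outs = e.outs := by cases e <;> rfl
@[simp] theorem isDot_shift (d : ℕ) (e : Piece) : (shift d e).isDot = e.isDot := by
  cases e <;> rfl

@[simp] theorem map_shift_zero (w : Word) : w.map (shift 0) = w := by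
  induction w <;> simp_all

theorem shift_comp_shift (d d' : ℕ) : shift d ∘ shift d' = shift (d' + d) :=
  funext (shift_shift d d')

theorem map_shift_shift (d d' : ℕ) (w : Word) :
    (w.map (shift d')).map (shift d) = w.map (shift (d' + d)) := by
  simp [List.map_map, Function.comp_def, shift_shift]

@[simp] theorem isTangle_nil {n m : ℕ} : IsTangle [] n m ↔ n = m := Iff.rfl

theorem isTangle_cons {e : Piece} {w : Word} {n m : ℕ} :
    IsTangle (e :: w) n m ↔ e.pos + e.ins ≤ n ∧ IsTangle w (n - e.ins + e.outs) m := Iff.rfl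

@[simp] theorem isTangle_cup {i : ℕ} {w : Word} {n m : ℕ} :
    IsTangle (cup i :: w) n m ↔ i ≤ n ∧ IsTangle w (n + 2) m := Iff.rfl

@[simp] theorem isTangle_cap {i : ℕ} {w : Word} {n m : ℕ} :
    IsTangle (cap i :: w) n m ↔ i + 2 ≤ n ∧ IsTangle w (n - 2) m := Iff.rfl

@[simp] theorem isTangle_cross {i : ℕ} {b : Bool} {w : Word} {n m : ℕ} :
    IsTangle (cross i b :: w) n m ↔ i + 2 ≤ n ∧ IsTangle w n m := by
  rw [isTangle_cons]
  refine and_congr_right fun h => ?_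
  simp only [pos, ins, outs] at h ⊢
  rw [Nat.sub_add_cancel (by omega)]

@[simp] theorem isTangle_dot {i : ℕ} {w : Word} {n m : ℕ} :
    IsTangle (dot i :: w) n m ↔ i + 1 ≤ n ∧ IsTangle w n m := by
  rw [isTangle_cons]
  refine and_congr_right fun h => ?_
  simp only [pos, ins, outs] at h ⊢
  rw [Nat.sub_add_cancel (by omega)]

theorem isTangle_append {u v : Word} {n m : ℕ} :
    IsTangle (u ++ v) n m ↔ ∃ k, IsTangle u n k ∧ IsTangle v k m := by
  induction u generalizing n with
  | nil => simp
  | cons e u ih => simp [isTangle_cons, ih, and_assoc]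

theorem IsTangle.append {u v : Word} {n k m : ℕ} (hu : IsTangle u n k) (hv : IsTangle v k m) :
    IsTangle (u ++ v) n m := isTangle_append.2 ⟨k, hu, hv⟩

theorem IsTangle.unique {w : Word} {n m m' : ℕ} (h : IsTangle w n m) (h' : IsTangle w n m') :
    m = m' := by
  induction w generalizing n with
  | nil => exact h.symm.trans h'
  | cons e w ih => exact ih h.2 h'.2

theorem IsTangle.map_shift {w : Word} {n m : ℕ} (h : IsTangle w n m) (k r : ℕ) :
    IsTangle (w.map (shift k)) (n + k + r) (m + k + r) := by
  induction w generalizing n with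
  | nil => simpa using h
  | cons e w ih =>
    obtain ⟨h₁, h₂⟩ := h
    refine ⟨by simp; omega, ?_⟩
    have := ih h₂
    simp only [ins_shift, outs_shift]
    rwa [show n + k + r - e.ins + e.outs = n - e.ins + e.outs + k + r by omega]

theorem IsTangle.shift_append {S w : Word} {a b k n m : ℕ} (h : IsTangle S a b) (hk : k + a ≤ n) :
    IsTangle (S.map (Piece.shift k) ++ w) n m ↔ IsTangle w (n - a + b) m := by
  obtain ⟨r, rfl⟩ := Nat.exists_eq_add_of_le hk
  have hS := h.map_shift k r
  rw [show k + a + r - a + b = b + k + r by omega, isTangle_append]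
  rw [Nat.add_comm a k] at hS
  exact ⟨fun ⟨j, h₁, h₂⟩ => hS.unique h₁ ▸ h₂, fun h₂ => ⟨_, hS, h₂⟩⟩

theorem IsTangle.append_iff {S w : Word} {a b n m : ℕ} (h : IsTangle S a b) (hk : a ≤ n) :
    IsTangle (S ++ w) n m ↔ IsTangle w (n - a + b) m := by
  simpa using h.shift_append (k := 0) (w := w) (by omega : 0 + a ≤ n)

theorem IsTangle.widen {w : Word} {n m : ℕ} (h : IsTangle w n m) (r : ℕ) :
    IsTangle w (n + r) (m + r) := by
  simpa using h.map_shift 0 r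

/-! ### Isotopy of tangles -/

/-- A local move applied inside a tangle diagram with `n` lower and `m` upper ends. -/
def TangleStep (n m : ℕ) (w w' : Word) : Prop :=
  ∃ u v l r, Move l r ∧ w = u ++ l ++ v ∧ w' = u ++ r ++ v ∧ IsTangle w n m ∧ IsTangle w' n m

/-- Isotopy of tangle diagrams with `n` lower and `m` upper ends, fixing the ends. -/
def TIso (n m : ℕ) : Word → Word → Prop := Relation.EqvGen (TangleStep n m)

namespace TIso

variable {n m : ℕ} {w w' w'' : Word}

theorem refl (w : Word) : TIso n m w w := Relation.EqvGen.refl _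

theorem symm (h : TIso n m w w') : TIso n m w' w := Relation.EqvGen.symm _ _ h

theorem trans (h : TIso n m w w') (h' : TIso n m w' w'') : TIso n m w w'' :=
  Relation.EqvGen.trans _ _ _ h h'

theorem of_eq (h : w = w') : TIso n m w w' := h ▸ refl _

theorem isTangle_iff (h : TIso n m w w') : IsTangle w n m ↔ IsTangle w' n m := by
  induction h with
  | rel _ _ h => obtain ⟨_, _, _, _, _, _, _, h₁, h₂⟩ := h; exact ⟨fun _ => h₂, fun _ => h₁⟩
  | refl => rfl
  | symm _ _ _ ih => exact ih.symm
  | trans _ _ _ _ _ ih₁ ih₂ => exact ih₁.trans ih₂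

theorem of_move (u v : Word) {l r : Word} (hm : Move l r) (h₁ : IsTangle (u ++ l ++ v) n m)
    (h₂ : IsTangle (u ++ r ++ v) n m) : TIso n m (u ++ l ++ v) (u ++ r ++ v) :=
  Relation.EqvGen.rel _ _ ⟨u, v, l, r, hm, rfl, rfl, h₁, h₂⟩

theorem append {a b : ℕ} {p q : Word} (hp : IsTangle p a n) (h : TIso n m w w')
    (hq : IsTangle q m b) : TIso a b (p ++ w ++ q) (p ++ w' ++ q) := by
  induction h with
  | rel _ _ h =>
    obtain ⟨u, v, l, r, hm, rfl, rfl, h₁, h₂⟩ := h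
    refine Relation.EqvGen.rel _ _ ⟨p ++ u, v ++ q, l, r, hm, by simp, by simp, ?_, ?_⟩
    · exact (hp.append h₁).append hq
    · exact (hp.append h₂).append hq
  | refl => exact refl _
  | symm _ _ _ ih => exact ih.symm
  | trans _ _ _ _ _ ih₁ ih₂ => exact ih₁.trans ih₂

theorem append_left {a : ℕ} {p : Word} (hp : IsTangle p a n) (h : TIso n m w w') :
    TIso a m (p ++ w) (p ++ w') := by
  simpa using h.append hp (q := []) rfl

theorem append_right {b : ℕ} {q : Word} (h : TIso n m w w') (hq : IsTangle q m b) :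
    TIso n b (w ++ q) (w' ++ q) := by
  simpa using h.append (p := []) rfl hq

end TIso

theorem Move.map_shift {l r : Word} (h : Move l r) (k : ℕ) :
    Move (l.map (shift k)) (r.map (shift k)) := by
  cases h with
  | exchange g h hgh =>
    have e : (g.moveTo (g.pos - h.ins + h.outs)).shift k =
        (g.shift k).moveTo ((g.shift k).pos - (h.shift k).ins + (h.shift k).outs) := by
      rw [pos_shift, ins_shift, outs_shift,
        show g.pos + k - h.ins + h.outs = g.pos - h.ins + h.outs + k by omega]
      cases g <;> rfl
    simp only [List.map_cons, List.map_nil, e]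
    exact .exchange _ _ (by simp; omega)
  | zigzagLeft i =>
    simpa [Nat.add_right_comm] using Move.zigzagLeft (i + k)
  | zigzagRight i => simpa [Nat.add_right_comm] using Move.zigzagRight (i + k)
  | pivotCap i b => simpa [Nat.add_right_comm] using Move.pivotCap (i + k) b
  | pivotCup i b => simpa [Nat.add_right_comm] using Move.pivotCup (i + k) b
  | reidemeisterOneCap i b => exact .reidemeisterOneCap (i + k) b
  | reidemeisterOneCup i b => exact .reidemeisterOneCup (i + k) b
  | reidemeisterTwo i b => exact .reidemeisterTwo (i + k) b
  | reidemeisterThree i b c d h =>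
    simpa [Nat.add_right_comm] using Move.reidemeisterThree (i + k) b c d h
  | dotCrossLeft i b => simpa [Nat.add_right_comm] using Move.dotCrossLeft (i + k) b
  | dotCrossRight i b => simpa [Nat.add_right_comm] using Move.dotCrossRight (i + k) b
  | dotCup i => simpa [Nat.add_right_comm] using Move.dotCup (i + k)
  | dotCap i => simpa [Nat.add_right_comm] using Move.dotCap (i + k)
  | dotDot i => exact .dotDot (i + k)

theorem TIso.map_shift {n m : ℕ} {w w' : Word} (h : TIso n m w w') (k r : ℕ) :
    TIso (n + k + r) (m + k + r) (w.map (Piece.shift k)) (w'.map (Piece.shift k)) := by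
  induction h with
  | rel _ _ h =>
    obtain ⟨u, v, l, s, hm, rfl, rfl, h₁, h₂⟩ := h
    exact Relation.EqvGen.rel _ _ ⟨u.map (Piece.shift k), v.map (Piece.shift k), _, _, hm.map_shift k,
      by simp, by simp, h₁.map_shift k r, h₂.map_shift k r⟩
  | refl => exact refl _
  | symm _ _ _ ih => exact ih.symm
  | trans _ _ _ _ _ ih₁ ih₂ => exact ih₁.trans ih₂

theorem TIso.isotopic {w w' : Word} (h : TIso 0 0 w w') : Isotopic w w' := by
  induction h with
  | rel _ _ h =>
    obtain ⟨u, v, l, r, hm, rfl, rfl, h₁, h₂⟩ := h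
    exact Relation.EqvGen.rel _ _ (.mk u v l r hm h₁ h₂)
  | refl => exact Relation.EqvGen.refl _
  | symm _ _ _ ih => exact Relation.EqvGen.symm _ _ ih
  | trans _ _ _ _ _ ih₁ ih₂ => exact Relation.EqvGen.trans _ _ _ ih₁ ih₂

theorem Isotopic.symm {w w' : Word} (h : Isotopic w w') : Isotopic w' w :=
  Relation.EqvGen.symm _ _ h

theorem Isotopic.trans {w w' w'' : Word} (h : Isotopic w w') (h' : Isotopic w' w'') :
    Isotopic w w'' := Relation.EqvGen.trans _ _ _ h h'

theorem Isotopic.tIso {w w' : Word} (h : Isotopic w w') : TIso 0 0 w w' := by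
  induction h with
  | rel _ _ h =>
    obtain ⟨u, v, l, r, hm, h₁, h₂⟩ := h
    exact TIso.of_move u v hm h₁ h₂
  | refl => exact .refl _
  | symm _ _ _ ih => exact ih.symm
  | trans _ _ _ _ _ ih₁ ih₂ => exact ih₁.trans ih₂

theorem Isotopic.isDiagram_iff {w w' : Word} (h : Isotopic w w') : IsDiagram w ↔ IsDiagram w' :=
  h.tIso.isTangle_iff

/-- A piece and a tangle to the right of it exchange their heights. -/
theorem TIso.exchange_piece {h : Piece} {a b b' : ℕ} (hh : h.pos + h.ins ≤ a) {B : Word}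
    (hB : IsTangle B b b') :
    TIso (b + a) (b' + (a - h.ins + h.outs)) (B.map (shift a) ++ [h])
      (h :: B.map (shift (a - h.ins + h.outs))) := by
  induction B generalizing b with
  | nil => exact .refl _
  | cons e B ih =>
    obtain ⟨h₁, h₂⟩ := hB
    set a' := a - h.ins + h.outs with ha'
    have hB' := h₂.map_shift a 0
    have hB'' := h₂.map_shift a' 0
    simp only [Nat.add_zero] at hB' hB''
    have e₁ : b + a - e.ins + e.outs = b - e.ins + e.outs + a := by omega
    have s₁ : TIso (b + a) (b' + a') (e.shift a :: (B.map (shift a) ++ [h]))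
        (e.shift a :: h :: B.map (shift a')) := by
      refine TIso.append_left (p := [e.shift a]) (n := b - e.ins + e.outs + a) ?_ (ih h₂)
      refine ⟨by simp; omega, ?_⟩
      simpa using e₁
    refine s₁.trans ?_
    have hm : Move [e.shift a, h] [h, e.shift a'] := by
      have := Move.exchange (e.shift a) h (by simp; omega)
      convert this using 3
      rw [pos_shift, show e.pos + a - h.ins + h.outs = e.pos + a' by omega]
      cases e <;> rfl
    refine TIso.of_move [] (B.map (shift a')) hm ?_ ?_
    · refine ⟨by simp; omega, by simp; omega, ?_⟩
      simpa [show b + a - e.ins + e.outs - h.ins + h.outs = b - e.ins + e.outs + a' by omega]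
        using hB''
    · refine ⟨by omega, by simp; omega, ?_⟩
      simpa [show b + a - h.ins + h.outs - e.ins + e.outs = b - e.ins + e.outs + a' by omega]
        using hB''

/-- Two tangles beside each other exchange their heights. -/
theorem TIso.exchange {A B : Word} {a a' b b' : ℕ} (hA : IsTangle A a a') (hB : IsTangle B b b') :
    TIso (b + a) (b' + a') (B.map (shift a) ++ A) (A ++ B.map (shift a')) := by
  induction A generalizing a with
  | nil => obtain rfl : a = a' := hA; simpa using TIso.refl _
  | cons h A ih =>
    obtain ⟨h₁, h₂⟩ := hA
    have hA' : IsTangle A (b' + (a - h.ins + h.outs)) (b' + a') := by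
      have := h₂.map_shift 0 b'
      simpa [Nat.add_comm] using this
    have s₁ := (TIso.exchange_piece h₁ hB).append_right hA'
    simp only [List.append_assoc, List.cons_append, List.nil_append] at s₁
    refine s₁.trans ?_
    refine TIso.append_left (p := [h]) ⟨by omega, ?_⟩ (ih h₂)
    simp; omega

theorem TIso.exchange' {A B : Word} {a a' b b' n m k k' : ℕ} (hA : IsTangle A a a')
    (hB : IsTangle B b b') (r : ℕ) (hk' : k' = k + a') (hn : n = k + a + b + r)
    (hm : m = k + a' + b' + r) :
    TIso n m (B.map (Piece.shift (k + a)) ++ A.map (Piece.shift k))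
      (A.map (Piece.shift k) ++ B.map (Piece.shift k')) := by
  have := (TIso.exchange hA hB).map_shift k r
  simp only [List.map_append, map_shift_shift] at this
  subst hk' hn hm
  convert this using 2
  · omega
  · omega
  · rw [Nat.add_comm]
  · rw [Nat.add_comm]

/-! ### Isotopies of tangles with four ends -/

/-- Two horizontal arcs, the unit of the horizontal sum. -/
abbrev horiz : Word := [cap 0, cup 0]

theorem isTangle_nil_two : IsTangle [] 2 2 := rfl

theorem isTangle_horiz : IsTangle horiz 2 2 := by simp

theorem isTangle_hsum {T S : Word} (hT : IsTangle T 2 2) (hS : IsTangle S 2 2) :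
    IsTangle (hsum T S) 2 2 := by
  simp [hsum, hT.append_iff, hS.shift_append]

theorem hsum_congr_left {T T' S : Word} (h : TIso 2 2 T T') (hS : IsTangle S 2 2) :
    TIso 2 2 (hsum T S) (hsum T' S) := by
  have := (h.map_shift 0 2).append (p := [cup 1]) (q := S.map (shift 2) ++ [cap 1]) (a := 2) (b := 2)
    (by simp) (by simp [hS.shift_append])
  simpa [hsum] using this

theorem hsum_congr_right {T S S' : Word} (h : TIso 2 2 S S') (hT : IsTangle T 2 2) :
    TIso 2 2 (hsum T S) (hsum T S') := by
  have := (h.map_shift 2 0).append (p := [cup 1] ++ T) (q := [cap 1]) (a := 2) (b := 2)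
    (by simpa using hT.widen 2)
    (by simp)
  simpa [hsum] using this

theorem hsum_horiz_left {S : Word} (hS : IsTangle S 2 2) : TIso 2 2 (hsum horiz S) S := by
  have s₁ := TIso.of_move (n := 2) (m := 2) [] ([cup 0] ++ S.map (shift 2) ++ [cap 1])
    (Move.zigzagRight 0) (by simp [hS.shift_append]) (by simp [hS.shift_append])
  have s₂ := (TIso.exchange (A := [cup 0]) (a := 0) (a' := 2) (by simp) hS).symm.append_right
    (q := [cap 1]) (b := 2) (by simp)
  have s₃ := TIso.of_move (n := 2) (m := 2) S [] (Move.zigzagLeft 0) (by simp [hS.append_iff])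
    (by simpa using hS)
  simp [hsum] at s₁ s₂ s₃ ⊢
  exact s₁.trans (s₂.trans s₃)

theorem hsum_horiz_right {S : Word} (hS : IsTangle S 2 2) : TIso 2 2 (hsum S horiz) S := by
  have s₁ := TIso.of_move (n := 2) (m := 2) ([cup 1] ++ S ++ [cap 2]) []
    (Move.zigzagRight 1) (by simp [hS.append_iff]) (by simp [hS.append_iff])
  have s₂ := (TIso.exchange (B := [cap 0]) (b := 2) (b' := 0) hS (by simp)).symm.append_left
    (p := [cup 1]) (a := 2) (by simp)
  have s₃ := TIso.of_move (n := 2) (m := 2) [] S (Move.zigzagLeft 1) (by simp [hS])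
    (by simpa using hS)
  simp [hsum] at s₁ s₂ s₃ ⊢
  exact s₁.trans (s₂.trans s₃)

theorem hsum_assoc {A B C : Word} (hA : IsTangle A 2 2) (hB : IsTangle B 2 2)
    (hC : IsTangle C 2 2) : TIso 2 2 (hsum (hsum A B) C) (hsum A (hsum B C)) := by
  have s₁ := ((TIso.exchange' (A := [cap 0]) (k := 1) (k' := 1) (n := 6) (m := 4)
    (a := 2) (a' := 0) (by simp) (hC.map_shift 1 0) 0 (by simp) (by simp) (by simp)).symm).append
    (p := [cup 1, cup 1] ++ A ++ B.map (shift 2)) (q := [cap 1]) (a := 2) (b := 2)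
    (by simp [hA.append_iff]; simpa using hB.map_shift 2 2) (by simp)
  have s₂ := TIso.of_move (n := 2) (m := 2)
    ([cup 1, cup 1] ++ A ++ B.map (shift 2) ++ C.map (shift 4)) []
    (Move.exchange (cap 3) (cap 1) le_rfl)
    (by simp [hA.append_iff, hB.shift_append, hC.shift_append])
    (by simp [pos, ins, outs, moveTo, hA.append_iff, hB.shift_append, hC.shift_append])
  have s₃ := TIso.of_move (n := 2) (m := 2) []
    (A ++ B.map (shift 2) ++ C.map (shift 4) ++ [cap 3, cap 1])
    (Move.exchange (cup 1) (cup 1) le_rfl)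
    (by simp [hA.append_iff, hB.shift_append, hC.shift_append])
    (by simp [pos, ins, outs, moveTo, hA.append_iff, hB.shift_append, hC.shift_append])
  have s₄ := (TIso.exchange' (B := [cup 1]) (k := 0) (k' := 2) (n := 4) (m := 6)
    (b := 2) (b' := 4) hA (by simp) 0 (by simp) (by simp) (by simp)).append
    (p := [cup 1]) (q := B.map (shift 2) ++ C.map (shift 4) ++ [cap 3, cap 1]) (a := 2) (b := 2)
    (by simp) (by simp [hB.shift_append, hC.shift_append])
  simp [hsum, pos, ins, outs, moveTo, shift_comp_shift] at s₁ s₂ s₃ s₄ ⊢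
  exact s₁.trans (s₂.symm.trans (s₃.trans s₄))

/-- Beside vertical strands the crossing is a curl: after a pivot around the maximum it sits
directly above a minimum, where the first Reidemeister move removes it. -/
theorem hsum_nil_cross (b : Bool) : TIso 2 2 (hsum [] [cross 0 b]) [] := by
  have s₁ := TIso.of_move (n := 2) (m := 2) [cup 1] [] (Move.pivotCap 1 (!b)) (by simp) (by simp)
  have s₂ := TIso.of_move (n := 2) (m := 2) [] [cap 2] (Move.reidemeisterOneCup 1 (!b))
    (by simp) (by simp)
  have s₃ := TIso.of_move (n := 2) (m := 2) [] [] (Move.zigzagLeft 1) (by simp) (by simp)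
  simp [hsum] at s₁ s₂ s₃ ⊢
  exact s₁.symm.trans (s₂.trans s₃)

theorem hsum_cross_nil (b : Bool) : TIso 2 2 (hsum [cross 0 b] []) [] := by
  have s₁ := TIso.of_move (n := 2) (m := 2) [cup 1] [] (Move.pivotCap 0 b) (by simp) (by simp)
  have s₂ := TIso.of_move (n := 2) (m := 2) [] [cap 0] (Move.reidemeisterOneCup 1 (!b))
    (by simp) (by simp)
  have s₃ := TIso.of_move (n := 2) (m := 2) [] [] (Move.zigzagRight 0) (by simp) (by simp)
  simp [hsum] at s₁ s₂ s₃ ⊢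
  exact s₁.trans (s₂.trans s₃)

/-- Pivoting both crossings onto the two middle strands puts them above one another with opposite
signs, where the second Reidemeister move applies. -/
theorem hsum_cross_cross (b : Bool) : TIso 2 2 (hsum [cross 0 b] [cross 0 (!b)]) horiz := by
  have s₁ := TIso.of_move (n := 2) (m := 2) [] [cross 2 (!b), cap 1] (Move.pivotCup 0 b)
    (by simp) (by simp)
  have s₂ := TIso.of_move (n := 2) (m := 2) [cup 0, cross 1 (!b)] [] (Move.pivotCap 1 b)
    (by simp) (by simp)
  have s₃ := TIso.of_move (n := 2) (m := 2) [cup 0] [cap 2] (Move.reidemeisterTwo 1 (!b))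
    (by simp) (by simp)
  have s₄ := TIso.of_move (n := 2) (m := 2) [] [] (Move.exchange (cap 0) (cup 0) le_rfl)
    (by simp) (by simp [pos, ins, outs, moveTo])
  simp [hsum, pos, ins, outs, moveTo] at s₁ s₂ s₃ s₄ ⊢
  exact s₁.trans (s₂.symm.trans (s₃.trans s₄.symm))

theorem horiz_append_cross (b : Bool) : TIso 2 2 (horiz ++ [cross 0 b]) horiz := by
  have s₁ := TIso.of_move (n := 2) (m := 2) [cap 0] [] (Move.reidemeisterOneCup 0 b)
    (by simp) (by simp)
  simpa using s₁

/-- Opposite half twists on adjacent sides of two neighbouring tangles cancel. -/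
theorem hsum_cross_hsum_cross {A B : Word} (hA : IsTangle A 2 2) (hB : IsTangle B 2 2) (b : Bool) :
    TIso 2 2 (hsum (hsum A [cross 0 b]) (hsum [cross 0 (!b)] B)) (hsum A B) := by
  have hc : ∀ b, IsTangle [cross 0 b] 2 2 := by simp
  refine (hsum_assoc hA (hc _) (isTangle_hsum (hc _) hB)).trans (hsum_congr_right ?_ hA)
  refine (hsum_assoc (hc _) (hc _) hB).symm.trans ?_
  exact (hsum_congr_left (hsum_cross_cross b) hB).trans (hsum_horiz_left hB)

/-- The link diagram obtained from a tangle by joining the upper ends and the lower ends. -/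
def closure (T : Word) : Word := [cup 0] ++ T ++ [cap 0]

/-- Opposite half twists on top of two neighbouring tangles cancel. -/
theorem closure_hsum_cross_cross {A B : Word} (hA : IsTangle A 2 2) (hB : IsTangle B 2 2)
    (b : Bool) :
    TIso 0 0 (closure (hsum (A ++ [cross 0 b]) (B ++ [cross 0 (!b)]))) (closure (hsum A B)) := by
  have s₀ := (TIso.exchange' (A := [cross 0 b]) (B := B) (k := 0) (k' := 2) (n := 4) (m := 4)
    (a := 2) (a' := 2) (by simp) hB 0 (by simp) (by simp) (by simp)).symm.append
    (p := [cup 0, cup 1] ++ A) (q := [cross 2 (!b), cap 1, cap 0]) (a := 0) (b := 0)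
    (by simpa using hA.widen 2) (by simp)
  set p := [cup 0, cup 1] ++ A ++ B.map (shift 2) with hp
  have hp' : IsTangle p 0 4 := by
    simp [hp, hA.append_iff]; simpa using hB.map_shift 2 0
  -- The crossing on top of `B` travels along the two closing maxima: it pivots around the inner
  -- one, the maxima exchange heights, and it pivots again. It then meets the opposite crossing on
  -- top of `A`.
  have s₁ := TIso.of_move (n := 4) (m := 0) [cross 0 b] [cap 0] (Move.pivotCap 1 b)
    (by simp) (by simp)
  have s₂ := TIso.of_move (n := 4) (m := 0) [cross 0 b, cross 1 b] []
    (Move.exchange (cap 2) (cap 0) le_rfl) (by simp) (by simp [pos, ins, outs, moveTo])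
  have s₃ := TIso.of_move (n := 4) (m := 0) [cross 0 b] [cap 0] (Move.pivotCap 0 (!b))
    (by simp) (by simp)
  have s₄ := TIso.of_move (n := 4) (m := 0) [] [cap 1, cap 0] (Move.reidemeisterTwo 0 b)
    (by simp) (by simp)
  simp [pos, ins, outs, moveTo] at s₁ s₂ s₃ s₄
  have s := ((s₁.symm.trans s₂).trans (s₃.symm.trans s₄)).append_left hp'
  simp [closure, hsum, hp] at s₀ s ⊢
  exact s₀.trans s

theorem closure_append_cross {A : Word} (hA : IsTangle A 2 2) (b : Bool) :
    TIso 0 0 (closure (A ++ [cross 0 b])) (closure A) := by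
  have s₁ := TIso.of_move (n := 0) (m := 0) ([cup 0] ++ A) [] (Move.reidemeisterOneCap 0 b)
    (by simp [hA.append_iff]) (by simp [hA.append_iff])
  simpa [closure] using s₁

/-! ### Dots on the ends of tangles -/

theorem cross_dot_zero (b : Bool) : TIso 2 2 [cross 0 b, dot 0] [dot 1, cross 0 b] :=
  (TIso.of_move [] [] (Move.dotCrossRight 0 b) (by simp) (by simp)).symm

theorem cross_dot_one (b : Bool) : TIso 2 2 [cross 0 b, dot 1] [dot 0, cross 0 b] :=
  (TIso.of_move [] [] (Move.dotCrossLeft 0 b) (by simp) (by simp)).symm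

theorem dot_zero_hsum {T S : Word} (hT : IsTangle T 2 2) (hS : IsTangle S 2 2) :
    TIso 2 2 (dot 0 :: hsum T S) (hsum (dot 0 :: T) S) := by
  have s := (TIso.exchange' (A := [dot 0]) (B := [cup 0]) (k := 0) (k' := 1) (n := 2) (m := 4)
    (a := 1) (a' := 1) (b := 0) (b' := 2) (by simp) (by simp) 1 (by simp) (by simp) (by simp))
    |>.symm.append_right (q := T ++ S.map (shift 2) ++ [cap 1]) (b := 2)
    (by simp [hT.append_iff, hS.shift_append])
  simpa [hsum] using s

theorem hsum_dot_zero {T S : Word} (hT : IsTangle T 2 2) (hS : IsTangle S 2 2) :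
    TIso 2 2 (hsum T S ++ [dot 0]) (hsum (T ++ [dot 0]) S) := by
  have s := (TIso.exchange' (A := [dot 0]) (B := S.map (shift 1) ++ [cap 0])
    (k := 0) (k' := 1) (n := 4) (m := 2)
    (a := 1) (a' := 1) (b := 3) (b' := 1) (by simp) (by simp [hS.shift_append]) 0 (by simp)
    (by simp) (by simp)).append_left (p := [cup 1] ++ T) (a := 2)
    (by simpa using hT.widen 2)
  simpa [hsum, shift_comp_shift] using s

/-- The lower right end of the sum runs through the crossing to its upper left end, which is joined
to the upper right end of `T`. The next lemma follows the other strand of the crossing. -/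
theorem dot_one_hsum_cross {T : Word} (hT : IsTangle T 2 2) (b : Bool) :
    TIso 2 2 (dot 1 :: hsum T [cross 0 b]) (hsum (T ++ [dot 1]) [cross 0 b]) := by
  have s₁ := TIso.of_move (n := 2) (m := 2) [] (T ++ [cross 2 b, cap 1])
    (Move.exchange (dot 1) (cup 1) (by simp [pos, ins]))
    (by simp [hT.append_iff]) (by simp [pos, ins, outs, moveTo, hT.append_iff])
  have s₂ := (TIso.exchange' (A := T) (B := [dot 1]) (k := 0) (k' := 2) (n := 4) (m := 4)
    (b := 2) (b' := 2) hT (by simp) 0 (by simp) (by simp) (by simp)).append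
    (p := [cup 1]) (q := [cross 2 b, cap 1]) (a := 2) (b := 2) (by simp) (by simp)
  have hp : IsTangle ([cup 1] ++ T) 2 4 := by simpa using hT.widen 2
  have s₃ := TIso.of_move (n := 4) (m := 2) [] [cap 1] (Move.dotCrossRight 2 b) (by simp) (by simp)
  have s₄ := TIso.of_move (n := 4) (m := 2) [cross 2 b] [] (Move.dotCap 1) (by simp) (by simp)
  have s₅ := TIso.of_move (n := 4) (m := 2) [] [cap 1] (Move.exchange (cross 2 b) (dot 1) le_rfl)
    (by simp) (by simp [pos, ins, outs, moveTo])
  simp [pos, ins, outs, moveTo] at s₁ s₂ s₃ s₄ s₅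
  have s := (s₃.trans (s₄.symm.trans s₅)).append_left hp
  simp [hsum] at s ⊢
  exact s₁.trans (s₂.trans s)

theorem hsum_cross_dot_one {T : Word} (hT : IsTangle T 2 2) (b : Bool) :
    TIso 2 2 (hsum T [cross 0 b] ++ [dot 1]) (hsum (dot 1 :: T) [cross 0 b]) := by
  have hp : IsTangle ([cup 1] ++ T) 2 4 := by simpa using hT.widen 2
  have s₁ := TIso.of_move (n := 4) (m := 2) [cross 2 b] [] (Move.exchange (dot 3) (cap 1) le_rfl)
    (by simp) (by simp [pos, ins, outs, moveTo])
  have s₂ := TIso.of_move (n := 4) (m := 2) [] [cap 1] (Move.dotCrossLeft 2 b) (by simp) (by simp)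
  have s₃ := (TIso.exchange' (A := T) (B := [dot 0]) (k := 0) (k' := 2) (n := 4) (m := 4)
    (b := 2) (b' := 2) hT (by simp) 0 (by simp) (by simp) (by simp)).append
    (p := [cup 1]) (q := [cross 2 b, cap 1]) (a := 2) (b := 2) (by simp) (by simp)
  have s₄ := TIso.of_move (n := 2) (m := 2) [] (T ++ [cross 2 b, cap 1]) (Move.dotCup 1)
    (by simp [hT.append_iff]) (by simp [hT.append_iff])
  simp [pos, ins, outs, moveTo] at s₁ s₂ s₃ s₄
  have s := (s₁.symm.trans s₂.symm).append_left hp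
  simp [hsum] at s ⊢
  exact s.trans (s₃.symm.trans s₄.symm)

/-- Two nested circles, each with a dot, form a split link. -/
theorem nested_circles :
    TIso 0 0 (closure (hsum [dot 0, dot 1] []))
      ([cup 0, dot 0, cap 0] ++ [cup 0, dot 0, cap 0]) := by
  have s₁ := TIso.of_move (n := 2) (m := 2) [] [dot 1, cap 1] (Move.exchange (cup 1) (dot 0) le_rfl)
    (by simp) (by simp [pos, ins, outs, moveTo])
  have s₂ := TIso.of_move (n := 2) (m := 2) [cup 1] [] (Move.dotCap 1) (by simp) (by simp)
  -- In the plane the inner circle can leave the outer one only by crossing it: a second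
  -- Reidemeister move creates two crossings with the left outer strand, the circle is pivoted to
  -- the other side, and a second such move removes them.
  have s₃ := TIso.of_move (n := 2) (m := 2) [cup 1] [dot 2, cap 1] (Move.reidemeisterTwo 0 true)
    (by simp) (by simp)
  have s₄ := TIso.of_move (n := 2) (m := 2) [cup 1, cross 0 true] [cap 1]
    (Move.exchange (dot 2) (cross 0 false) le_rfl) (by simp) (by simp [pos, ins, outs, moveTo])
  have s₅ := TIso.of_move (n := 2) (m := 2) [] [dot 2, cross 0 false, cap 1] (Move.pivotCup 0 true)
    (by simp) (by simp)
  have s₆ := TIso.of_move (n := 2) (m := 2) [cup 0, cross 1 false, dot 2] []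
    (Move.pivotCap 0 false) (by simp) (by simp)
  have s₇ := TIso.of_move (n := 2) (m := 2) [cup 0] [cross 1 true, cap 0]
    (Move.dotCrossLeft 1 false) (by simp) (by simp)
  have s₈ := TIso.of_move (n := 2) (m := 2) [cup 0, dot 1] [cap 0]
    (Move.reidemeisterTwo 1 false) (by simp) (by simp)
  have s₉ := TIso.of_move (n := 2) (m := 2) [] [cap 0] (Move.dotCup 0) (by simp) (by simp)
  simp [pos, ins, outs, moveTo] at s₁ s₂ s₃ s₄ s₅ s₆ s₇ s₈ s₉
  have s := s₂.trans <| s₃.symm.trans <| s₄.symm.trans <| s₅.trans <| s₆.trans <| s₇.symm.trans <|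
    s₈.trans s₉.symm
  have s' := (s₁.trans (s.append_left (p := [dot 0]) (by simp))).append (p := [cup 0])
    (q := [cap 0]) (a := 0) (b := 0) (by simp) (by simp)
  have t := (TIso.exchange (A := [cup 0, dot 0, cap 0]) (B := [cup 0, dot 0]) (a := 0) (a' := 0)
    (b := 0) (b' := 2) (by simp) (by simp)).append_right (q := [cap 0]) (b := 0) (by simp)
  simp [closure, hsum] at s' t ⊢
  exact s'.trans t

/-! ### Counting components by colourings

The strands of a diagram are coloured with two colours; the colours at a given height form an
infinite sequence, of which only an initial part matters. -/

/-- Two new strands of colour `c` are inserted at `i`. -/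
def insertPair (i : ℕ) (c : Bool) (α : ℕ → Bool) : ℕ → Bool :=
  fun j => if j < i then α j else if j < i + 2 then c else α (j - 2)

/-- The strands `i` and `i + 1` are removed. -/
def removePair (i : ℕ) (α : ℕ → Bool) : ℕ → Bool :=
  fun j => if j < i then α j else α (j + 2)

/-- The strands `i` and `i + 1` are exchanged. -/
def swapPair (i : ℕ) (α : ℕ → Bool) : ℕ → Bool :=
  fun j => if j = i then α (i + 1) else if j = i + 1 then α i else α j

/-- The number of colourings of a diagram by two colours that are constant on components and
restrict to `α` at the bottom. -/
def numColorings : Word → (ℕ → Bool) → ℕ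
  | [], _ => 1
  | cup i :: w, α => numColorings w (insertPair i false α) + numColorings w (insertPair i true α)
  | cap i :: w, α => if α i = α (i + 1) then numColorings w (removePair i α) else 0
  | cross i _ :: w, α => numColorings w (swapPair i α)
  | dot _ :: w, α => numColorings w α

/-- `α` and `β` are the colours below and above the piece in a colouring. -/
def Compatible (e : Piece) (α β : ℕ → Bool) : Prop :=
  (∀ j < e.pos, α j = β j) ∧ (∀ j, α (e.pos + e.ins + j) = β (e.pos + e.outs + j)) ∧
    match e with
    | cup i => β i = β (i + 1)
    | cap i => α i = α (i + 1)
    | cross i _ => α i = β (i + 1) ∧ α (i + 1) = β i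
    | dot i => α i = β i

theorem compatible_cup {i : ℕ} {α β : ℕ → Bool} :
    Compatible (cup i) α β ↔ β = insertPair i false α ∨ β = insertPair i true α := by
  have key : ∀ c, β = insertPair i c α ↔ Compatible (cup i) α β ∧ β i = c := by
    intro c
    constructor
    · rintro rfl
      refine ⟨⟨?_, ?_, ?_⟩, ?_⟩
      · intro j hj; simp only [pos] at hj; simp [insertPair, hj]
      · intro j
        change α (i + 0 + j) = insertPair i c α (i + 2 + j)
        simp only [insertPair]
        rw [if_neg (by omega), if_neg (by omega)]; congr 1; omega
      · simp [insertPair]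
      · simp [insertPair]
    · rintro ⟨⟨h₁, h₂, h₃⟩, h₄⟩
      simp only [pos, ins, outs] at h₁ h₂
      funext j
      unfold insertPair
      split_ifs with h h'
      · exact (h₁ j h).symm
      · obtain rfl | rfl : j = i ∨ j = i + 1 := by omega
        · exact h₄
        · exact h₃.symm.trans h₄
      · have := h₂ (j - 2 - i)
        rw [show i + 0 + (j - 2 - i) = j - 2 by omega, show i + 2 + (j - 2 - i) = j by omega] at this
        exact this.symm
  rw [key, key]
  cases β i <;> simp

theorem compatible_cap {i : ℕ} {α β : ℕ → Bool} :
    Compatible (cap i) α β ↔ α i = α (i + 1) ∧ β = removePair i α := by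
  constructor
  · rintro ⟨h₁, h₂, h₃⟩
    refine ⟨h₃, ?_⟩
    simp only [pos, ins, outs] at h₁ h₂
    funext j
    unfold removePair
    split_ifs with h
    · exact (h₁ j h).symm
    · have := h₂ (j - i)
      rw [show i + 2 + (j - i) = j + 2 by omega, show i + 0 + (j - i) = j by omega] at this
      exact this.symm
  · rintro ⟨h, rfl⟩
    refine ⟨?_, ?_, h⟩
    · intro j hj; simp only [pos] at hj; simp [removePair, hj]
    · intro j
      change α (i + 2 + j) = removePair i α (i + 0 + j)
      simp only [removePair]
      rw [if_neg (by omega)]; congr 1; omega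

theorem compatible_cross {i : ℕ} {b : Bool} {α β : ℕ → Bool} :
    Compatible (cross i b) α β ↔ β = swapPair i α := by
  constructor
  · rintro ⟨h₁, h₂, h₃, h₄⟩
    simp only [pos, ins, outs] at h₁ h₂
    funext j
    unfold swapPair
    split_ifs with h h'
    · rw [h, h₄]
    · rw [h', h₃]
    · rcases lt_or_ge j i with hj | hj
      · exact (h₁ j hj).symm
      · have := h₂ (j - 2 - i)
        rw [show i + 2 + (j - 2 - i) = j by omega] at this
        exact this.symm
  · rintro rfl
    refine ⟨?_, ?_, ?_, ?_⟩
    · intro j hj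
      simp only [pos] at hj
      simp only [swapPair]
      rw [if_neg (by omega), if_neg (by omega)]
    · intro j
      change α (i + 2 + j) = swapPair i α (i + 2 + j)
      simp only [swapPair]
      rw [if_neg (by omega), if_neg (by omega)]
    · simp [swapPair]
    · simp [swapPair]

theorem compatible_dot {i : ℕ} {α β : ℕ → Bool} : Compatible (dot i) α β ↔ β = α := by
  constructor
  · rintro ⟨h₁, h₂, h₃⟩
    simp only [pos, ins, outs] at h₁ h₂
    funext j
    rcases lt_trichotomy j i with hj | rfl | hj
    · exact (h₁ j hj).symm
    · exact h₃.symm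
    · have := h₂ (j - 1 - i)
      rw [show i + 1 + (j - 1 - i) = j by omega] at this
      exact this.symm
  · rintro rfl
    exact ⟨fun _ _ => rfl, fun _ => rfl, rfl⟩

/-- `f k` are the colours above the first `k` pieces in a colouring of `w`. -/
def IsColoring (w : Word) (f : ℕ → ℕ → Bool) : Prop :=
  (∀ k e, w[k]? = some e → Compatible e (f k) (f (k + 1))) ∧ ∀ k, w.length ≤ k → f k = f w.length

theorem isColoring_nil {f : ℕ → ℕ → Bool} : IsColoring [] f ↔ f = fun _ => f 0 := by
  simp [IsColoring, funext_iff]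

theorem isColoring_cons {e : Piece} {w : Word} {f : ℕ → ℕ → Bool} :
    IsColoring (e :: w) f ↔ Compatible e (f 0) (f 1) ∧ IsColoring w (fun k => f (k + 1)) := by
  constructor
  · rintro ⟨h₁, h₂⟩
    exact ⟨h₁ 0 e (by simp), fun k e' he => h₁ (k + 1) e' (by simpa using he),
      fun k hk => h₂ (k + 1) (by simpa using hk)⟩
  · rintro ⟨h₀, h₁, h₂⟩
    refine ⟨?_, ?_⟩
    · rintro (_ | k) e' he
      · obtain rfl : e = e' := by simpa using he
        exact h₀
      · exact h₁ k e' (by simpa using he)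
    · rintro (_ | k) hk
      · simp at hk
      · exact h₂ k (by simpa using hk)

/-- The colourings with the colours `α` at the bottom. -/
def colorings (w : Word) (α : ℕ → Bool) : Set (ℕ → ℕ → Bool) := {f | IsColoring w f ∧ f 0 = α}

theorem colorings_cons (e : Piece) (w : Word) (α : ℕ → Bool) :
    colorings (e :: w) α =
      (fun f k => Nat.casesOn k α f) '' {f | Compatible e α (f 0) ∧ IsColoring w f} := by
  ext f
  simp only [colorings, isColoring_cons, Set.mem_ofPred_eq, Set.mem_image]
  constructor
  · rintro ⟨⟨h₁, h₂⟩, rfl⟩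
    refine ⟨fun k => f (k + 1), ⟨h₁, h₂⟩, ?_⟩
    funext k; cases k <;> rfl
  · rintro ⟨g, ⟨h₁, h₂⟩, rfl⟩
    exact ⟨⟨h₁, h₂⟩, rfl⟩

/-- A colouring is determined from the bottom upwards. Only a minimum leaves a choice, that of the
colour of the new strands; only a maximum imposes a condition. -/
theorem colorings_finite_and_ncard (w : Word) (α : ℕ → Bool) :
    (colorings w α).Finite ∧ (colorings w α).ncard = numColorings w α := by
  induction w generalizing α with
  | nil =>
    have : colorings [] α = {fun _ => α} := by
      ext f
      simp only [colorings, isColoring_nil, Set.mem_ofPred_eq, Set.mem_singleton_iff]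
      constructor
      · rintro ⟨h, rfl⟩; exact h
      · rintro rfl; simp
    simp [this, numColorings]
  | cons e w ih =>
    have inj : Function.Injective
        (fun (f : ℕ → ℕ → Bool) (k : ℕ) => (Nat.casesOn k α f : ℕ → Bool)) := by
      intro f g h
      funext k
      exact congrFun h (k + 1)
    rw [colorings_cons, Set.ncard_image_of_injective _ inj]
    suffices h : {f | Compatible e α (f 0) ∧ IsColoring w f}.Finite ∧
        {f | Compatible e α (f 0) ∧ IsColoring w f}.ncard = numColorings (e :: w) α from
      ⟨h.1.image _, h.2⟩
    cases e with
    | cup i =>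
      have hd : Disjoint (colorings w (insertPair i false α)) (colorings w (insertPair i true α)) := by
        rw [Set.disjoint_left]
        rintro f ⟨_, hf⟩ ⟨_, hf'⟩
        have := congrFun (hf.symm.trans hf') i
        simp [insertPair] at this
      have : {f | Compatible (cup i) α (f 0) ∧ IsColoring w f} =
          colorings w (insertPair i false α) ∪ colorings w (insertPair i true α) := by
        ext f; simp only [compatible_cup, colorings, Set.mem_ofPred_eq, Set.mem_union]; tauto
      rw [this, Set.ncard_union_eq hd (ih _).1 (ih _).1, (ih _).2, (ih _).2]
      exact ⟨(ih _).1.union (ih _).1, rfl⟩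
    | cap i =>
      by_cases h : α i = α (i + 1)
      · have : {f | Compatible (cap i) α (f 0) ∧ IsColoring w f} =
            colorings w (removePair i α) := by
          ext f; simp only [compatible_cap, colorings, Set.mem_ofPred_eq]; tauto
        rw [this, numColorings, if_pos h]
        exact ih _
      · simp [compatible_cap, h, numColorings]
    | cross i b =>
      have : {f | Compatible (cross i b) α (f 0) ∧ IsColoring w f} =
          colorings w (swapPair i α) := by
        ext f; simp only [compatible_cross, colorings, Set.mem_ofPred_eq]; tauto
      rw [this, numColorings]
      exact ih _
    | dot i =>
      have : {f | Compatible (dot i) α (f 0) ∧ IsColoring w f} = colorings w α := by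
        ext f; simp only [compatible_dot, colorings, Set.mem_ofPred_eq]; tauto
      rw [this, numColorings]
      exact ih _

/-! ### Components correspond to colourings. -/

theorem IsTangle.foldl_eq {w : Word} {n m : ℕ} (h : IsTangle w n m) :
    w.foldl (fun n e => n - e.ins + e.outs) n = m := by
  induction w generalizing n with
  | nil => exact h
  | cons e w ih => exact ih h.2

theorem IsTangle.width_eq {w : Word} {m : ℕ} (h : IsTangle w 0 m) : width w = m := h.foldl_eq

theorem width_take_succ {w : Word} {k : ℕ} {e : Piece} (he : w[k]? = some e) :
    width (w.take (k + 1)) = width (w.take k) - e.ins + e.outs := by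
  simp [width, List.take_add_one, he]

theorem IsTangle.pos_add_ins_le {w : Word} {m : ℕ} (h : IsTangle w 0 m) {k : ℕ} {e : Piece}
    (he : w[k]? = some e) : e.pos + e.ins ≤ width (w.take k) := by
  obtain ⟨hk, rfl⟩ := List.getElem?_eq_some_iff.1 he
  rw [← List.take_append_drop k w, List.drop_eq_getElem_cons hk, isTangle_append] at h
  obtain ⟨j, h₁, h₂, -⟩ := h
  rwa [h₁.width_eq]

theorem finite_point (w : Word) : Finite (Point w) := by
  refine Set.Finite.to_subtype (s := {p : ℕ × ℕ | p.1 ≤ w.length ∧ p.2 < width (w.take p.1)}) ?_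
  refine Set.Finite.subset (((Finset.range (w.length + 1)).sigma
    fun k => Finset.range (width (w.take k))).image fun p => (p.1, p.2)).finite_toSet ?_
  rintro ⟨k, i⟩ ⟨h₁, h₂⟩
  simp only [Finset.coe_image, Set.mem_image, Finset.mem_coe, Finset.mem_sigma, Finset.mem_range]
  exact ⟨⟨k, i⟩, ⟨by simp at h₁ ⊢; omega, h₂⟩, rfl⟩

theorem finite_component (w : Word) : Finite (Component w) :=
  have := finite_point w
  Quot.finite _

theorem IsColoring.eq_of_joined {w : Word} {f : ℕ → ℕ → Bool} (hf : IsColoring w f)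
    {p q : ℕ × ℕ} (h : Joined w p q) : f p.1 p.2 = f q.1 q.2 := by
  cases h with
  | left k e he i hi => exact (hf.1 k e he).1 i hi
  | right k e he i => exact (hf.1 k e he).2.1 i
  | cup k i he => exact (hf.1 k _ he).2.2
  | cap k i he => exact (hf.1 k _ he).2.2
  | crossUp k i b he => exact (hf.1 k _ he).2.2.1
  | crossDown k i b he => exact (hf.1 k _ he).2.2.2
  | dot k i he => exact (hf.1 k _ he).2.2

/-- Positions beyond the last strand carry no part of the diagram. Each piece merely shifts them, so
they keep the value `false` from the bottom. -/
theorem IsColoring.eq_false {w : Word} {m : ℕ} (hw : IsTangle w 0 m) {f : ℕ → ℕ → Bool}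
    (hf : IsColoring w f) (h₀ : f 0 = fun _ => false) {k i : ℕ} (hk : k ≤ w.length)
    (hi : width (w.take k) ≤ i) : f k i = false := by
  induction k generalizing i with
  | zero => simp [h₀]
  | succ k ih =>
    have he : w[k]? = some (w[k]'hk) := List.getElem?_eq_getElem hk
    set e := w[k]'hk
    have h₁ := hw.pos_add_ins_le he
    rw [width_take_succ he] at hi
    have h₂ := (hf.1 k e he).2.1 (i - (e.pos + e.outs))
    rw [show e.pos + e.outs + (i - (e.pos + e.outs)) = i by omega] at h₂
    rw [← h₂]
    exact ih (by omega) (by omega)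

open Classical in
/-- The colouring of a diagram by a function on the set of components. -/
noncomputable def ofComponents (w : Word) (φ : Component w → Bool) (k i : ℕ) : Bool :=
  -- The minimum freezes the sequence above the top of the diagram, as `IsColoring` demands;
  -- positions without a strand receive the default `false`.
  if h : min k w.length ≤ w.length ∧ i < width (w.take (min k w.length)) then
    φ (Quot.mk _ ⟨(min k w.length, i), h⟩) else false

theorem ofComponents_point {w : Word} (φ : Component w → Bool) (p : Point w) :
    ofComponents w φ p.1.1 p.1.2 = φ (Quot.mk _ p) := by
  obtain ⟨⟨k, i⟩, h₁, h₂⟩ := p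
  simp only at h₁ h₂
  have hk : min k w.length = k := min_eq_left h₁
  simp only [ofComponents, hk]
  rw [dif_pos ⟨h₁, h₂⟩]

theorem ofComponents_of_le {w : Word} (φ : Component w → Bool) {k i : ℕ}
    (h : width (w.take k) ≤ i) (hk : k ≤ w.length) : ofComponents w φ k i = false := by
  have hk : min k w.length = k := min_eq_left hk
  simp only [ofComponents, hk]
  rw [dif_neg (by omega)]

theorem ofComponents_eq_of_joined {w : Word} (φ : Component w → Bool) {k i k' i' : ℕ}
    (hp : k ≤ w.length ∧ i < width (w.take k)) (hq : k' ≤ w.length ∧ i' < width (w.take k'))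
    (h : Joined w (k, i) (k', i')) : ofComponents w φ k i = ofComponents w φ k' i' := by
  rw [ofComponents_point φ ⟨(k, i), hp⟩, ofComponents_point φ ⟨(k', i'), hq⟩]
  exact congrArg φ (Quot.sound h)

theorem isColoring_ofComponents {w : Word} {m : ℕ} (hw : IsTangle w 0 m)
    (φ : Component w → Bool) : IsColoring w (ofComponents w φ) := by
  refine ⟨fun k e he => ?_, fun k hk => ?_⟩
  · have hk : k < w.length := (List.getElem?_eq_some_iff.1 he).1
    have h₁ := hw.pos_add_ins_le he
    have h₂ := width_take_succ he
    refine ⟨fun j hj => ?_, fun j => ?_, ?_⟩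
    · exact ofComponents_eq_of_joined φ ⟨by omega, by omega⟩ ⟨by omega, by omega⟩
        (.left k e he j hj)
    · rcases lt_or_ge (e.pos + e.ins + j) (width (w.take k)) with h | h
      · exact ofComponents_eq_of_joined φ ⟨by omega, by omega⟩ ⟨by omega, by omega⟩
          (.right k e he j)
      · rw [ofComponents_of_le φ h (by omega), ofComponents_of_le φ (by omega) (by omega)]
    · cases e with
      | cup i =>
        simp only [pos, ins, outs] at h₁ h₂
        exact ofComponents_eq_of_joined φ ⟨by omega, by omega⟩ ⟨by omega, by omega⟩ (.cup k i he)
      | cap i =>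
        simp only [pos, ins, outs] at h₁ h₂
        exact ofComponents_eq_of_joined φ ⟨by omega, by omega⟩ ⟨by omega, by omega⟩ (.cap k i he)
      | cross i b =>
        simp only [pos, ins, outs] at h₁ h₂
        exact ⟨ofComponents_eq_of_joined φ ⟨by omega, by omega⟩ ⟨by omega, by omega⟩
          (.crossUp k i b he), ofComponents_eq_of_joined φ ⟨by omega, by omega⟩
          ⟨by omega, by omega⟩ (.crossDown k i b he)⟩
      | dot i =>
        simp only [pos, ins, outs] at h₁ h₂
        exact ofComponents_eq_of_joined φ ⟨by omega, by omega⟩ ⟨by omega, by omega⟩ (.dot k i he)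
  · funext i
    simp [ofComponents, min_eq_right hk]

/-- The functions on the set of components correspond to the colourings of the diagram. -/
noncomputable def componentsEquiv {w : Word} {m : ℕ} (hw : IsTangle w 0 m) :
    (Component w → Bool) ≃ colorings w (fun _ => false) where
  toFun φ := ⟨ofComponents w φ, isColoring_ofComponents hw φ, by
    funext i
    exact ofComponents_of_le φ (by simp [width]) (by simp)⟩
  invFun f := Quot.lift (fun p => f.1 p.1.1 p.1.2) fun _ _ h => f.2.1.eq_of_joined h
  left_inv φ := by
    funext c
    induction c using Quot.ind with
    | mk p => exact ofComponents_point φ p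
  right_inv f := by
    apply Subtype.ext
    funext k i
    have hk : f.1 k i = f.1 (min k w.length) i := by
      rcases le_total k w.length with h | h
      · rw [min_eq_left h]
      · rw [min_eq_right h, f.2.1.2 k h]
    simp only [ofComponents]
    split_ifs with h
    · exact hk.symm
    · rw [hk, f.2.1.eq_false hw f.2.2 (min_le_right _ _) (by simp at h ⊢; omega)]

/-- A colouring is a function from components to two colours. This trades the quotient `Component`
for the recursion defining `numColorings`. At the bottom there are no strands, and the constant
`false` is only a default. -/
theorem two_pow_numComponents {w : Word} (hw : IsDiagram w) :
    2 ^ numComponents w = numColorings w (fun _ => false) := by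
  have := finite_component w
  rw [← (colorings_finite_and_ncard w _).2, ← Nat.card_coe_set_eq,
    ← Nat.card_congr (componentsEquiv hw), Nat.card_fun, Nat.card_eq_fintype_card (α := Bool),
    Fintype.card_bool, numComponents]

/-- The recursion starts at the bottom, so a relation that holds for all upper parts `v` and all
initial colours survives putting any `u` below. -/
theorem numColorings_append_congr {l r : Word} {c : ℕ}
    (h : ∀ v α, numColorings (l ++ v) α = c * numColorings (r ++ v) α) (u v : Word)
    (α : ℕ → Bool) : numColorings (u ++ l ++ v) α = c * numColorings (u ++ r ++ v) α := by
  induction u generalizing α with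
  | nil => exact h v α
  | cons e u ih =>
    simp only [List.append_assoc] at ih
    cases e <;> simp [numColorings, ih, mul_add]

/-! ### Erasing dots, and local relations between colour counts. -/

@[simp] theorem eraseDots_nil : eraseDots [] = [] := rfl
@[simp] theorem eraseDots_cup (i : ℕ) (w : Word) : eraseDots (cup i :: w) = cup i :: eraseDots w :=
  rfl
@[simp] theorem eraseDots_cap (i : ℕ) (w : Word) : eraseDots (cap i :: w) = cap i :: eraseDots w :=
  rfl
@[simp] theorem eraseDots_cross (i : ℕ) (b : Bool) (w : Word) :
    eraseDots (cross i b :: w) = cross i b :: eraseDots w := rfl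
@[simp] theorem eraseDots_dot (i : ℕ) (w : Word) : eraseDots (dot i :: w) = eraseDots w := rfl

@[simp] theorem eraseDots_append (u v : Word) :
    eraseDots (u ++ v) = eraseDots u ++ eraseDots v := List.filter_append ..

@[simp] theorem eraseDots_map_shift (k : ℕ) (w : Word) :
    eraseDots (w.map (shift k)) = (eraseDots w).map (shift k) := by
  induction w with
  | nil => rfl
  | cons e w ih => cases e <;> simp [ih]

theorem numColorings_eraseDots (w : Word) (α : ℕ → Bool) :
    numColorings (eraseDots w) α = numColorings w α := by
  induction w generalizing α with
  | nil => rfl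
  | cons e w ih =>
    cases e <;> simp [numColorings, ih]

@[simp] theorem insertPair_self (i : ℕ) (c : Bool) (α : ℕ → Bool) : insertPair i c α i = c := by
  simp [insertPair]

@[simp] theorem insertPair_succ (i : ℕ) (c : Bool) (α : ℕ → Bool) :
    insertPair i c α (i + 1) = c := by
  simp [insertPair]

theorem insertPair_add_two (i j : ℕ) (c : Bool) (α : ℕ → Bool) :
    insertPair i c α (i + j + 2) = α (i + j) := by
  simp only [insertPair]
  rw [if_neg (by omega), if_neg (by omega), Nat.add_sub_cancel]

theorem numColorings_zigzagLeft (i : ℕ) (v : Word) (α : ℕ → Bool) :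
    numColorings (cup i :: cap (i + 1) :: v) α = numColorings v α := by
  have h : ∀ c, removePair (i + 1) (insertPair i c α) = fun j => if j = i then c else α j := by
    intro c
    funext j
    simp only [removePair, insertPair]
    split_ifs <;> first | rfl | omega
  have h' : ∀ c, α i = c → removePair (i + 1) (insertPair i c α) = α := by
    rintro c rfl
    rw [h]
    funext j
    split_ifs with hj
    · rw [hj]
    · rfl
  simp only [numColorings, insertPair_succ, insertPair_add_two i 0]
  rcases hc : α i with _ | _
  · rw [if_pos (by simp), if_neg (by simp), h' _ hc, add_zero]
  · rw [if_neg (by simp), if_pos (by simp), h' _ hc, zero_add]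

theorem numColorings_zigzagRight (i : ℕ) (v : Word) (α : ℕ → Bool) :
    numColorings (cup (i + 1) :: cap i :: v) α = numColorings v α := by
  have h' : ∀ c, α i = c → removePair i (insertPair (i + 1) c α) = α := by
    rintro c rfl
    funext j
    simp only [removePair, insertPair]
    split_ifs <;> first | rfl | (congr 1; omega)
  simp only [numColorings]
  rcases hc : α i with _ | _
  · rw [if_pos (by simp [insertPair, hc]), if_neg (by simp [insertPair, hc]), h' _ hc, add_zero]
  · rw [if_neg (by simp [insertPair, hc]), if_pos (by simp [insertPair, hc]), h' _ hc, zero_add]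

theorem numColorings_cup_cap_comm (i : ℕ) (v : Word) (α : ℕ → Bool) :
    numColorings (cup i :: cap (i + 2) :: v) α = numColorings (cap i :: cup i :: v) α := by
  have h : ∀ c, removePair (i + 2) (insertPair i c α) = insertPair i c (removePair i α) := by
    intro c
    funext j
    simp only [removePair, insertPair]
    split_ifs <;> first | rfl | (congr 1; omega)
  simp only [numColorings, h]
  have h₁ : ∀ c, insertPair i c α (i + 2) = α i := fun c => insertPair_add_two i 0 c α
  have h₂ : ∀ c, insertPair i c α (i + 2 + 1) = α (i + 1) := fun c => insertPair_add_two i 1 c α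
  simp only [h₁, h₂]
  split_ifs <;> rfl

theorem numColorings_circle (i : ℕ) (v : Word) (α : ℕ → Bool) :
    numColorings (cup i :: cap i :: v) α = 2 * numColorings v α := by
  have h : ∀ c, removePair i (insertPair i c α) = α := by
    intro c
    funext j
    simp only [removePair, insertPair]
    split_ifs <;> first | rfl | (congr 1; omega)
  simp only [numColorings, h]
  rw [if_pos (by simp [insertPair]), if_pos (by simp [insertPair]), two_mul]

theorem two_le_numColorings {u v : Word} {n : ℕ} (hu : IsTangle u 0 n) (hn : 0 < n)
    (h : IsDiagram (u ++ v)) : 2 ≤ numColorings (u ++ v) (fun _ => false) := by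
  rw [← two_pow_numComponents h]
  have := finite_component (u ++ v)
  have : Nonempty (Component (u ++ v)) :=
    ⟨Quot.mk _ ⟨(u.length, 0), by simp, by simpa [hu.width_eq] using hn⟩⟩
  exact Nat.le_self_pow Nat.card_pos.ne' 2

theorem isTangle_eraseDots {w : Word} {n m : ℕ} (h : IsTangle w n m) :
    IsTangle (eraseDots w) n m := by
  induction w generalizing n with
  | nil => exact h
  | cons e w ih =>
    cases e with
    | dot i => simpa using ih (isTangle_dot.1 h).2
    | _ => exact ⟨h.1, ih h.2⟩

theorem numComponents_eraseDots {w : Word} (hw : IsDiagram w) :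
    numComponents (eraseDots w) = numComponents w := by
  apply Nat.pow_right_injective le_rfl
  simp only [two_pow_numComponents hw, two_pow_numComponents (isTangle_eraseDots hw : IsDiagram _),
    numColorings_eraseDots]

/-! ### The Kauffman bracket at `exp (iπ/4)` -/

/-- The value of the variable of the Kauffman bracket that gives the determinant. -/
noncomputable def rootA : ℂ := Complex.exp (Complex.I * Real.pi / 4)

theorem rootA_ne_zero : rootA ≠ 0 := Complex.exp_ne_zero _

theorem rootA_sq : rootA ^ 2 = Complex.I := by
  rw [rootA, ← Complex.exp_nat_mul,
    show ((2 : ℕ) : ℂ) * (Complex.I * Real.pi / 4) = Real.pi / 2 * Complex.I by push_cast; ring]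
  exact Complex.exp_pi_div_two_mul_I

theorem norm_rootA : ‖rootA‖ = 1 := by
  rw [rootA, show Complex.I * Real.pi / 4 = ((Real.pi / 4 : ℝ) : ℂ) * Complex.I by push_cast; ring]
  exact Complex.norm_exp_ofReal_mul_I _

/-- The value of a circle vanishes, so only the Kauffman states with one component contribute to the
bracket of a nonempty diagram. -/
theorem rootA_loop : -rootA ^ 2 - (rootA ^ 2)⁻¹ = 0 := by
  rw [rootA_sq, Complex.inv_I]; ring

theorem rootA_eq : rootA = Complex.I * rootA⁻¹ := by
  rw [← rootA_sq, sq, mul_assoc, mul_inv_cancel₀ rootA_ne_zero, mul_one]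

theorem rootA_inv_eq : rootA⁻¹ = -Complex.I * rootA := by
  refine inv_eq_of_mul_eq_one_right ?_
  rw [show rootA * (-Complex.I * rootA) = -(Complex.I * rootA ^ 2) by ring, rootA_sq,
    Complex.I_mul_I, neg_neg]

/-- The Kauffman bracket at `rootA`. -/
noncomputable abbrev br (w : Word) : ℂ := bracket rootA w

theorem linkDet_eq (w : Word) : linkDet w = ‖br w‖ := rfl

/-- The sum over the Kauffman states, with weight `G` on crossingless diagrams. -/
noncomputable def stateSum (G : Word → ℂ) (w : Word) : ℂ :=
  ((states w).map (fun s => rootA ^ s.1 * G s.2)).sum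

theorem stateSum_congr {G G' : Word → ℂ} {w : Word} (h : ∀ s ∈ states w, G s.2 = G' s.2) :
    stateSum G w = stateSum G' w := by
  unfold stateSum
  congr 1
  exact List.map_congr_left fun s hs => by rw [h s hs]

theorem br_eq_stateSum (w : Word) :
    br w = stateSum (fun x => (-rootA ^ 2 - (rootA ^ 2)⁻¹) ^ (numComponents x - 1)) w := rfl

/-- The coefficient of the smoothing with two vertical strands. -/
noncomputable def vcoeff (b : Bool) : ℂ := if b then rootA else rootA⁻¹

/-- The coefficient of the smoothing with two horizontal arcs. -/
noncomputable def hcoeff (b : Bool) : ℂ := if b then rootA⁻¹ else rootA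

theorem stateSum_nil (G : Word → ℂ) : stateSum G [] = G [] := by simp [stateSum, states]

theorem stateSum_cross (G : Word → ℂ) (i : ℕ) (b : Bool) (w : Word) :
    stateSum G (cross i b :: w) =
      vcoeff b * stateSum G w + hcoeff b * stateSum (fun x => G (cap i :: cup i :: x)) w := by
  simp only [stateSum, states, List.map_append, List.map_map, List.sum_append,
    ← List.sum_map_mul_left]
  congr 2
  · refine List.map_congr_left fun s _ => ?_
    cases b <;> simp [vcoeff, zpow_add₀ rootA_ne_zero] <;> ring
  · refine List.map_congr_left fun s _ => ?_
    cases b <;> simp [hcoeff, zpow_add₀ rootA_ne_zero, zpow_sub₀ rootA_ne_zero] <;> ring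

theorem stateSum_cup (G : Word → ℂ) (i : ℕ) (w : Word) :
    stateSum G (cup i :: w) = stateSum (fun x => G (cup i :: x)) w := by
  simp [stateSum, states, Function.comp_def]

theorem stateSum_cap (G : Word → ℂ) (i : ℕ) (w : Word) :
    stateSum G (cap i :: w) = stateSum (fun x => G (cap i :: x)) w := by
  simp [stateSum, states, Function.comp_def]

theorem stateSum_dot (G : Word → ℂ) (i : ℕ) (w : Word) :
    stateSum G (dot i :: w) = stateSum (fun x => G (dot i :: x)) w := by
  simp [stateSum, states, Function.comp_def]

/-- Locality of the state sum. It can be stated because the weight `G` is arbitrary: the sum over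
the upper part becomes a new weight for the lower part. -/
theorem stateSum_append (G : Word → ℂ) (u v : Word) :
    stateSum G (u ++ v) = stateSum (fun x => stateSum (fun y => G (x ++ y)) v) u := by
  induction u generalizing G with
  | nil => simp [stateSum_nil]
  | cons e u ih =>
    cases e <;> simp [stateSum_cross, stateSum_cup, stateSum_cap, stateSum_dot, ih]

theorem stateSum_linear (G G' : Word → ℂ) (x y : ℂ) (w : Word) :
    stateSum (fun z => x * G z + y * G' z) w = x * stateSum G w + y * stateSum G' w := by
  simp only [stateSum, ← List.sum_map_mul_left, ← List.sum_map_add]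
  congr 1
  exact List.map_congr_left fun s _ => by ring

theorem br_cross (u v : Word) (i : ℕ) (b : Bool) :
    br (u ++ [cross i b] ++ v) =
      vcoeff b * br (u ++ v) + hcoeff b * br (u ++ [cap i, cup i] ++ v) := by
  simp only [br_eq_stateSum, List.append_assoc, stateSum_append, stateSum_cross, stateSum_cup,
    stateSum_cap, stateSum_linear, List.cons_append, List.nil_append]

theorem isTangle_of_mem_states {w : Word} {n m : ℕ} (h : IsTangle w n m) {s : ℤ × Word}
    (hs : s ∈ states w) : IsTangle s.2 n m := by
  induction w generalizing n s with
  | nil => simp only [states, List.mem_singleton] at hs; subst hs; exact h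
  | cons e w ih =>
    cases e with
    | cross i b =>
      obtain ⟨h₁, h₂⟩ := isTangle_cross.1 h
      simp only [states, List.mem_append, List.mem_map] at hs
      obtain ⟨t, ht, rfl⟩ | ⟨t, ht, rfl⟩ := hs
      · exact ih (s := t) h₂ ht
      · refine isTangle_cap.2 ⟨h₁, isTangle_cup.2 ⟨by omega, ?_⟩⟩
        rw [Nat.sub_add_cancel (by omega)]
        exact ih (s := t) h₂ ht
    | cup i =>
      simp only [states, List.mem_map] at hs
      obtain ⟨t, ht, rfl⟩ := hs
      exact ⟨h.1, ih h.2 ht⟩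
    | cap i =>
      simp only [states, List.mem_map] at hs
      obtain ⟨t, ht, rfl⟩ := hs
      exact ⟨h.1, ih h.2 ht⟩
    | dot i =>
      simp only [states, List.mem_map] at hs
      obtain ⟨t, ht, rfl⟩ := hs
      exact ⟨h.1, ih h.2 ht⟩

/-- The weight of a crossingless diagram: `1` for the diagrams with at most one component. -/
noncomputable def weight (w : Word) : ℂ := if numColorings w (fun _ => false) ≤ 2 then 1 else 0

theorem br_eq_stateSum_weight {w : Word} (hw : IsDiagram w) : br w = stateSum weight w := by
  rw [br_eq_stateSum]
  refine stateSum_congr fun s hs => ?_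
  have hd : IsDiagram s.2 := isTangle_of_mem_states hw hs
  rw [weight, ← two_pow_numComponents hd, rootA_loop]
  have key : 2 ^ numComponents s.2 ≤ 2 ↔ numComponents s.2 - 1 = 0 := by
    rw [Nat.sub_eq_zero_iff_le]
    exact Nat.pow_le_pow_iff_right (n := numComponents s.2) (m := 1) (a := 2) (by norm_num)
  by_cases h : numComponents s.2 - 1 = 0
  · rw [if_pos (key.2 h), h, pow_zero]
  · rw [if_neg (fun h' => h (key.1 h')), zero_pow h]

theorem stateSum_append_crossingless (G : Word → ℂ) {u l v : Word} (hl : states l = [(0, l)]) :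
    stateSum G (u ++ l ++ v) = stateSum (fun x => stateSum (fun y => G (x ++ l ++ y)) v) u := by
  have h : ∀ F, stateSum F l = F l := fun F => by simp [stateSum, hl]
  simp only [List.append_assoc, stateSum_append, h]

/-- The weight of a state depends only on its number of colourings, so crossingless pieces with
equal colour counts are interchangeable inside any diagram. -/
theorem br_congr {u v l r : Word} (hl : states l = [(0, l)]) (hr : states r = [(0, r)])
    (h : ∀ v α, numColorings (l ++ v) α = numColorings (r ++ v) α)
    (hd : IsDiagram (u ++ l ++ v)) (hd' : IsDiagram (u ++ r ++ v)) :
    br (u ++ l ++ v) = br (u ++ r ++ v) := by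
  have h' : ∀ x y, weight (x ++ l ++ y) = weight (x ++ r ++ y) := fun x y => by
    rw [weight, weight, numColorings_append_congr (c := 1) (r := r) (by simpa using h), one_mul]
  rw [br_eq_stateSum_weight hd, br_eq_stateSum_weight hd', stateSum_append_crossingless _ hl,
    stateSum_append_crossingless _ hr]
  simp only [h']

/-- A diagram with a split circle has bracket zero. -/
theorem br_eq_zero {u v l r : Word} {n m : ℕ} (hl : states l = [(0, l)])
    (h : ∀ v α, numColorings (l ++ v) α = 2 * numColorings (r ++ v) α)
    (hu : IsTangle u 0 n) (hn : 0 < n) (hd : IsDiagram (u ++ l ++ v))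
    (hr : IsTangle r n m) (hv : IsTangle v m 0) : br (u ++ l ++ v) = 0 := by
  rw [br_eq_stateSum_weight hd, stateSum_append_crossingless _ hl]
  have : ∀ x ∈ states u, ∀ y ∈ states v, weight (x.2 ++ l ++ y.2) = 0 := fun x hx y hy => by
    have hx' := isTangle_of_mem_states hu hx
    have hy' := isTangle_of_mem_states hv hy
    rw [weight, numColorings_append_congr h, List.append_assoc, if_neg]
    -- The rest of the diagram must be nonempty, which `hn` ensures: a lone circle has exponent
    -- `numComponents - 1 = 0` and weight 1.
    have := two_le_numColorings (v := r ++ y.2) hx' hn (hx'.append (hr.append hy'))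
    omega
  rw [stateSum_congr (G' := fun _ => 0)]
  · simp [stateSum]
  · intro x hx
    rw [stateSum_congr (G' := fun _ => 0)]
    · simp [stateSum]
    · exact fun y hy => this x hx y hy

theorem eraseDots_eraseDots (w : Word) : eraseDots (eraseDots w) = eraseDots w := by
  simp [eraseDots]

theorem stateSum_eraseDots {G : Word → ℂ} (hG : ∀ x, G (eraseDots x) = G x) (w : Word) :
    stateSum G (eraseDots w) = stateSum G w := by
  induction w generalizing G with
  | nil => rfl
  | cons e w ih =>
    have hG' : ∀ e, ∀ x, G (e :: eraseDots x) = G (e :: x) := fun e x => by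
      rw [← hG, ← hG (e :: x)]; cases e <;> simp [eraseDots_eraseDots]
    cases e with
    | cross i b =>
      rw [eraseDots_cross, stateSum_cross, stateSum_cross, ih hG, ih]
      intro x
      rw [← hG, ← hG (cap i :: cup i :: x)]
      simp [eraseDots_eraseDots]
    | cup i => rw [eraseDots_cup, stateSum_cup, stateSum_cup, ih (hG' _)]
    | cap i => rw [eraseDots_cap, stateSum_cap, stateSum_cap, ih (hG' _)]
    | dot i =>
      rw [eraseDots_dot, stateSum_dot, ih hG]
      refine stateSum_congr fun s _ => ?_
      rw [← hG (dot i :: _), eraseDots_dot, hG]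

theorem br_eraseDots {w : Word} (hw : IsDiagram w) : br (eraseDots w) = br w := by
  rw [br_eq_stateSum_weight hw, br_eq_stateSum_weight (isTangle_eraseDots hw : IsDiagram _)]
  exact stateSum_eraseDots (fun x => by rw [weight, weight, numColorings_eraseDots]) w

theorem linkDet_eraseDots {w : Word} (hw : IsDiagram w) : linkDet (eraseDots w) = linkDet w := by
  rw [linkDet_eq, linkDet_eq, br_eraseDots hw]

/-! ### Contexts for tangles with four ends -/

/-- A link diagram with a hole for a tangle with four ends, at the strands `off` and `off + 1`. -/
structure Context where
  lower : Word
  upper : Word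
  off : ℕ
  wid : ℕ
  off_le : off + 2 ≤ wid
  isTangle_lower : IsTangle lower 0 wid
  isTangle_upper : IsTangle upper wid 0

namespace Context

/-- The link diagram obtained by inserting a tangle into the hole. -/
def plug (C : Context) (T : Word) : Word := C.lower ++ T.map (shift C.off) ++ C.upper

theorem isTangle_map_shift (C : Context) {T : Word} (hT : IsTangle T 2 2) :
    IsTangle (T.map (shift C.off)) C.wid C.wid := by
  have := hT.map_shift C.off (C.wid - (2 + C.off))
  rwa [Nat.add_sub_cancel' (by have := C.off_le; omega)] at this

theorem isDiagram_plug (C : Context) {T : Word} (hT : IsTangle T 2 2) : IsDiagram (C.plug T) :=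
  (C.isTangle_lower.append (C.isTangle_map_shift hT)).append C.isTangle_upper

theorem isotopic_plug (C : Context) {T T' : Word} (h : TIso 2 2 T T') :
    Isotopic (C.plug T) (C.plug T') := by
  have := h.map_shift C.off (C.wid - (2 + C.off))
  rw [Nat.add_sub_cancel' (by have := C.off_le; omega)] at this
  exact (this.append C.isTangle_lower C.isTangle_upper).isotopic

/-- The context of `T` in `T ++ S`. -/
def above (C : Context) (S : Word) (hS : IsTangle S 2 2) : Context where
  lower := C.lower
  upper := S.map (shift C.off) ++ C.upper
  off := C.off
  wid := C.wid
  off_le := C.off_le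
  isTangle_lower := C.isTangle_lower
  isTangle_upper := (C.isTangle_map_shift hS).append C.isTangle_upper

@[simp] theorem plug_above (C : Context) (S : Word) (hS : IsTangle S 2 2) (T : Word) :
    (C.above S hS).plug T = C.plug (T ++ S) := by
  simp [plug, above]

/-- The context of `T` in `S ++ T`. -/
def below (C : Context) (S : Word) (hS : IsTangle S 2 2) : Context where
  lower := C.lower ++ S.map (shift C.off)
  upper := C.upper
  off := C.off
  wid := C.wid
  off_le := C.off_le
  isTangle_lower := C.isTangle_lower.append (C.isTangle_map_shift hS)
  isTangle_upper := C.isTangle_upper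

@[simp] theorem plug_below (C : Context) (S : Word) (hS : IsTangle S 2 2) (T : Word) :
    (C.below S hS).plug T = C.plug (S ++ T) := by
  simp [plug, below]

/-- The context of `T` in `hsum T S`. -/
def left (C : Context) (S : Word) (hS : IsTangle S 2 2) : Context where
  lower := C.lower ++ [cup (C.off + 1)]
  upper := S.map (shift (C.off + 2)) ++ [cap (C.off + 1)] ++ C.upper
  off := C.off
  wid := C.wid + 2
  off_le := by have := C.off_le; omega
  isTangle_lower := C.isTangle_lower.append (by have := C.off_le; simp; omega)
  isTangle_upper := by
    have := C.off_le
    rw [List.append_assoc, hS.shift_append (by omega)]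
    simpa using ⟨by omega, C.isTangle_upper⟩

@[simp] theorem plug_left (C : Context) (S : Word) (hS : IsTangle S 2 2) (T : Word) :
    (C.left S hS).plug T = C.plug (hsum T S) := by
  simp [plug, left, hsum, shift_comp_shift, Nat.add_comm]

/-- The context of `T` in `hsum S T`. -/
def right (C : Context) (S : Word) (hS : IsTangle S 2 2) : Context where
  lower := C.lower ++ [cup (C.off + 1)] ++ S.map (shift C.off)
  upper := [cap (C.off + 1)] ++ C.upper
  off := C.off + 2
  wid := C.wid + 2
  off_le := by have := C.off_le; omega
  isTangle_lower := by
    have := C.off_le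
    refine IsTangle.append (k := C.wid + 2) (C.isTangle_lower.append ?_) ?_
    · simp; omega
    · have h := hS.map_shift C.off (C.wid - C.off)
      rwa [show 2 + C.off + (C.wid - C.off) = C.wid + 2 by omega] at h
  isTangle_upper := by
    have := C.off_le
    simpa using ⟨by omega, C.isTangle_upper⟩

@[simp] theorem plug_right (C : Context) (S : Word) (hS : IsTangle S 2 2) (T : Word) :
    (C.right S hS).plug T = C.plug (hsum S T) := by
  simp [plug, right, hsum, shift_comp_shift, Nat.add_comm]

/-- The context of `T` in the closure of `T`. -/
def outer : Context where
  lower := [cup 0]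
  upper := [cap 0]
  off := 0
  wid := 2
  off_le := le_rfl
  isTangle_lower := by simp
  isTangle_upper := by simp

@[simp] theorem plug_outer (T : Word) : outer.plug T = closure T := by
  simp [plug, outer, closure]

end Context

/-! ### Evaluation of tangles -/

/-- The tangle `T` equals `x` times two vertical strands plus `y` times two horizontal arcs in the
Kauffman bracket skein module. -/
def Evals (T : Word) (x y : ℂ) : Prop :=
  ∀ C : Context, br (C.plug T) = x * br (C.plug []) + y * br (C.plug horiz)

theorem evals_nil : Evals [] 1 0 := fun C => by ring
theorem evals_horiz : Evals horiz 0 1 := fun C => by ring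

theorem evals_cross (b : Bool) : Evals [cross 0 b] (vcoeff b) (hcoeff b) := fun C => by
  simpa [Context.plug] using br_cross C.lower C.upper C.off b

theorem br_plug_horiz_horiz (C : Context) : br (C.plug (horiz ++ horiz)) = 0 := by
  have := C.off_le
  have h := br_eq_zero (u := C.lower) (v := C.upper) (n := C.wid) (m := C.wid) (r := horiz.map (shift C.off))
    (l := (horiz ++ horiz).map (shift C.off)) (by simp [states]) ?_ C.isTangle_lower (by omega)
    (C.isDiagram_plug (isTangle_horiz.append isTangle_horiz))
    (C.isTangle_map_shift isTangle_horiz) C.isTangle_upper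
  · exact h
  · intro v α
    have := numColorings_append_congr (c := 2) (l := [cup C.off, cap C.off]) (r := [])
      (fun v α => numColorings_circle C.off v α) [cap C.off] (cup C.off :: v) α
    simpa using this

theorem br_plug_hsum_nil_nil (C : Context) : br (C.plug (hsum [] [])) = 0 := by
  have := C.off_le
  have h := br_eq_zero (u := C.lower) (v := C.upper) (n := C.wid) (m := C.wid) (r := [])
    (l := (hsum [] []).map (shift C.off)) (by simp [states, hsum]) ?_ C.isTangle_lower (by omega)
    (C.isDiagram_plug (isTangle_hsum isTangle_nil_two isTangle_nil_two)) rfl C.isTangle_upper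
  · exact h
  · intro v α
    simpa [hsum, Nat.add_comm] using numColorings_circle (C.off + 1) v α

theorem br_plug_congr (C : Context) {T T' : Word} (hT : IsTangle T 2 2) (hT' : IsTangle T' 2 2)
    (hl : states (T.map (shift C.off)) = [(0, T.map (shift C.off))])
    (hr : states (T'.map (shift C.off)) = [(0, T'.map (shift C.off))])
    (h : ∀ v α, numColorings (T.map (shift C.off) ++ v) α =
      numColorings (T'.map (shift C.off) ++ v) α) : br (C.plug T) = br (C.plug T') :=
  br_congr hl hr h (C.isDiagram_plug hT) (C.isDiagram_plug hT')

theorem br_plug_hsum_nil_horiz (C : Context) : br (C.plug (hsum [] horiz)) = br (C.plug []) := by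
  refine br_plug_congr C (isTangle_hsum isTangle_nil_two isTangle_horiz) rfl (by simp [states, hsum])
    (by simp [states]) fun v α => ?_
  simp only [hsum, horiz, List.map_cons, List.map_nil, List.cons_append, List.nil_append,
    shift_cup, shift_cap, Nat.zero_add]
  rw [show 2 + C.off = 1 + C.off + 1 by omega, numColorings_zigzagLeft, numColorings_zigzagRight]

theorem br_plug_hsum_horiz_nil (C : Context) : br (C.plug (hsum horiz [])) = br (C.plug []) := by
  refine br_plug_congr C (isTangle_hsum isTangle_horiz isTangle_nil_two) rfl (by simp [states, hsum])
    (by simp [states]) fun v α => ?_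
  simp only [hsum, horiz, List.map_cons, List.map_nil, List.cons_append, List.nil_append,
    shift_cup, shift_cap, Nat.zero_add]
  rw [show 1 + C.off = C.off + 1 by omega, numColorings_zigzagRight, numColorings_zigzagLeft]

theorem br_plug_hsum_horiz_horiz (C : Context) :
    br (C.plug (hsum horiz horiz)) = br (C.plug horiz) := by
  refine br_plug_congr C (isTangle_hsum isTangle_horiz isTangle_horiz) isTangle_horiz
    (by simp [states, hsum]) (by simp [states]) fun v α => ?_
  simp only [hsum, horiz, List.map_cons, List.map_nil, List.cons_append, List.nil_append,
    shift_cup, shift_cap, Nat.zero_add]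
  rw [show 1 + C.off = C.off + 1 by omega, show 2 + C.off = C.off + 1 + 1 by omega,
    numColorings_zigzagRight]
  have := numColorings_append_congr (c := 1) (l := [cup (C.off + 1 + 1), cap (C.off + 1)])
    (r := []) (fun v α => by simpa using numColorings_zigzagRight (C.off + 1) v α)
    [cup C.off, cap (C.off + 2)] v α
  simp only [List.cons_append, List.nil_append, List.append_nil, one_mul] at this
  rw [this, numColorings_cup_cap_comm]

theorem br_closure_nil : br (closure []) = 1 := by
  have hd : IsDiagram (closure []) := by simp [IsDiagram, closure]
  rw [br_eq_stateSum_weight hd]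
  simp [stateSum, closure, states, weight, numColorings]

theorem br_closure_horiz : br (closure horiz) = 0 := by
  refine br_eq_zero (u := [cup 0]) (l := [cap 0, cup 0, cap 0]) (r := [cap 0]) (v := []) (n := 2)
    (m := 0) (by simp [states]) ?_ (by simp) (by simp) (by simp [IsDiagram]) (by simp) rfl
  intro v α
  simpa using numColorings_append_congr (c := 2) (l := [cup 0, cap 0]) (r := [])
    (fun v α => numColorings_circle 0 v α) [cap 0] v α

/-- Vertical strands are the unit for stacking, and `horiz ++ horiz` contains a circle of value 0,
so the term `y * y'` disappears. -/
theorem Evals.append {T S : Word} {x y x' y' : ℂ} (hT : Evals T x y) (hS : Evals S x' y')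
    (hS' : IsTangle S 2 2) :
    Evals (T ++ S) (x * x') (x * y' + y * x') := fun C => by
  have h₁ := hT (C.above S hS')
  have h₂ := hS (C.below horiz isTangle_horiz)
  simp only [Context.plug_above, Context.plug_below] at h₁ h₂
  rw [h₁, h₂, br_plug_horiz_horiz, List.nil_append, List.append_nil, hS C]
  ring

/-- Horizontal arcs are the unit for the horizontal sum, and two pairs of vertical strands side by
side enclose a circle of value 0, so the term `x * x'` disappears. -/
theorem Evals.hsum {T S : Word} {x y x' y' : ℂ} (hT : Evals T x y) (hS : Evals S x' y')
    (hS' : IsTangle S 2 2) :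
    Evals (hsum T S) (x * y' + y * x') (y * y') := fun C => by
  have h₁ := hT (C.left S hS')
  have h₂ := hS (C.right [] isTangle_nil_two)
  have h₃ := hS (C.right horiz isTangle_horiz)
  simp only [Context.plug_left, Context.plug_right] at h₁ h₂ h₃
  rw [h₁, h₂, h₃, br_plug_hsum_horiz_horiz, br_plug_hsum_nil_nil, br_plug_hsum_nil_horiz,
    br_plug_hsum_horiz_nil]
  ring

theorem Evals.of_eraseDots {T : Word} {x y : ℂ} (hT : IsTangle T 2 2)
    (h : Evals (eraseDots T) x y) : Evals T x y := fun C => by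
  rw [← h C, ← br_eraseDots (C.isDiagram_plug hT),
    ← br_eraseDots (C.isDiagram_plug (isTangle_eraseDots hT))]
  simp [Context.plug, eraseDots_eraseDots]

theorem Evals.br_closure {T : Word} {x y : ℂ} (h : Evals T x y) : br (closure T) = x := by
  have := h Context.outer
  simp only [Context.plug_outer, br_closure_nil, br_closure_horiz] at this
  simpa using this

/-- The tangle behaves like a rational tangle `1 / ρ`. -/
def HasSlope (T : Word) (ρ : ℝ) : Prop := ∃ c : ℂ, Evals T (c * Complex.I * ρ) c

/-- The sign of a crossing. -/
def sgn (b : Bool) : ℝ := if b then 1 else -1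

/-- The quotient of the two smoothing coefficients is `A ^ 2 = i` or its inverse `-i`. All slopes
are real for this reason. -/
theorem vcoeff_eq (b : Bool) : vcoeff b = hcoeff b * Complex.I * sgn b := by
  cases b
  · simp only [vcoeff, hcoeff, sgn, Bool.false_eq_true, if_false]
    rw [rootA_inv_eq]; push_cast; ring
  · simp only [vcoeff, hcoeff, sgn, if_true]
    exact rootA_eq.trans (by push_cast; ring)

theorem norm_hcoeff (b : Bool) : ‖hcoeff b‖ = 1 := by cases b <;> simp [hcoeff, norm_rootA]

theorem hasSlope_cross (b : Bool) : HasSlope [cross 0 b] (sgn b) :=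
  ⟨hcoeff b, by rw [← vcoeff_eq]; exact evals_cross b⟩

theorem hasSlope_horiz : HasSlope horiz 0 := ⟨1, by simpa using evals_horiz⟩

theorem HasSlope.hsum {T S : Word} {ρ σ : ℝ} (hT : HasSlope T ρ) (hS : HasSlope S σ)
    (hS' : IsTangle S 2 2) : HasSlope (hsum T S) (ρ + σ) := by
  obtain ⟨c, hc⟩ := hT
  obtain ⟨d, hd⟩ := hS
  refine ⟨c * d, ?_⟩
  convert hc.hsum hd hS' using 1
  push_cast; ring

/-- Under stacking the inverses of the slopes add, as the numbers of the tangles should. -/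
theorem HasSlope.append {T S : Word} {ρ σ : ℝ} (hT : HasSlope T ρ) (hS : HasSlope S σ)
    (hS' : IsTangle S 2 2) (h : ρ + σ ≠ 0) : HasSlope (T ++ S) (ρ * σ / (ρ + σ)) := by
  obtain ⟨c, hc⟩ := hT
  obtain ⟨d, hd⟩ := hS
  refine ⟨c * d * Complex.I * (ρ + σ), ?_⟩
  have h' : (ρ : ℂ) + σ ≠ 0 := by exact_mod_cast h
  convert hc.append hd hS' using 1
  · push_cast; field_simp
  · ring

/-! ### Sliding dots -/

/-- A dot passes a piece to its right. -/
theorem TIso.dot_left {e : Piece} {i n m : ℕ} (h : IsTangle [e] n m) (hi : i < e.pos) :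
    TIso n m [dot i, e] [e, dot i] := by
  have hm := Move.exchange e (dot i) (by simpa [pos, ins] using hi)
  have he : e.moveTo (e.pos - (dot i).ins + (dot i).outs) = e := by
    have : e.pos - (dot i).ins + (dot i).outs = e.pos := by simp only [ins, outs]; omega
    rw [this]; cases e <;> rfl
  rw [he] at hm
  obtain ⟨h₁, h₂⟩ := h
  refine (TIso.of_move [] [] hm ?_ ?_).symm
  · refine ⟨h₁, isTangle_dot.2 ⟨?_, h₂⟩⟩
    omega
  · exact isTangle_dot.2 ⟨by omega, h₁, h₂⟩

/-- A dot passes a piece to its left. -/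
theorem TIso.dot_right {e : Piece} {i n m : ℕ} (h : IsTangle [e] n m) (hi : e.pos + e.ins ≤ i)
    (hn : i < n) : TIso n m [dot i, e] [e, dot (i - e.ins + e.outs)] := by
  have hm := Move.exchange (dot i) e (by simpa [pos, ins] using hi)
  obtain ⟨h₁, h₂⟩ := h
  refine TIso.of_move [] [] hm ?_ ?_
  · exact isTangle_dot.2 ⟨by omega, h₁, h₂⟩
  · refine ⟨h₁, isTangle_dot.2 ⟨?_, h₂⟩⟩
    simp only [pos]; omega

theorem TIso.dot_up_piece {e : Piece} {i n m : ℕ} (h : IsTangle [e] n m) (hi : i < n)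
    (he : ∀ j, e = cap j → i ≠ j ∧ i ≠ j + 1) : ∃ j, TIso n m [dot i, e] [e, dot j] := by
  rcases lt_or_ge i e.pos with h' | h'
  · exact ⟨_, TIso.dot_left h h'⟩
  rcases le_or_gt (e.pos + e.ins) i with h'' | h''
  · exact ⟨_, TIso.dot_right h h'' hi⟩
  cases e with
  | cup j => simp only [pos, ins] at h' h''; omega
  | cap j => simp only [pos, ins] at h' h''; have := he j rfl; omega
  | dot j =>
    simp only [pos, ins] at h' h''
    obtain rfl : i = j := by omega
    exact ⟨i, .refl _⟩
  | cross j b =>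
    simp only [pos, ins] at h' h''
    simp only [isTangle_cross, isTangle_nil] at h
    obtain rfl | rfl : i = j ∨ i = j + 1 := by omega
    · exact ⟨_, TIso.of_move [] [] (Move.dotCrossLeft i b) (by simp; omega) (by simp; omega)⟩
    · exact ⟨_, TIso.of_move [] [] (Move.dotCrossRight j b) (by simp; omega) (by simp; omega)⟩

theorem TIso.dot_down_piece {e : Piece} {i n m : ℕ} (h : IsTangle [e] n m) (hi : i < m)
    (he : ∀ j, e = cup j → i ≠ j ∧ i ≠ j + 1) : ∃ j, TIso n m [e, dot i] [dot j, e] := by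
  have h₁ : e.pos + e.ins ≤ n := h.1
  have h₂ : n - e.ins + e.outs = m := h.2
  rcases lt_or_ge i e.pos with h' | h'
  · exact ⟨_, (TIso.dot_left h h').symm⟩
  rcases le_or_gt (e.pos + e.outs) i with h'' | h''
  · have := TIso.dot_right (i := i - e.outs + e.ins) h (by omega) (by omega)
    rw [show i - e.outs + e.ins - e.ins + e.outs = i by omega] at this
    exact ⟨_, this.symm⟩
  cases e with
  | cap j => simp only [pos, outs] at h' h''; omega
  | cup j => simp only [pos, outs] at h' h''; have := he j rfl; omega
  | dot j =>
    simp only [pos, outs] at h' h''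
    obtain rfl : i = j := by omega
    exact ⟨i, .refl _⟩
  | cross j b =>
    simp only [pos, outs] at h' h''
    simp only [isTangle_cross, isTangle_nil] at h
    obtain rfl | rfl : i = j ∨ i = j + 1 := by omega
    · exact ⟨_, (TIso.of_move [] [] (Move.dotCrossRight i b) (by simp; omega)
        (by simp; omega)).symm⟩
    · exact ⟨_, (TIso.of_move [] [] (Move.dotCrossLeft j b) (by simp; omega)
        (by simp; omega)).symm⟩

theorem TIso.dot_up {w : Word} {i n m : ℕ} (h : IsTangle w n m) (hi : i < n)
    (hw : ∀ j, cap j ∉ w) : ∃ j, TIso n m (dot i :: w) (w ++ [dot j]) := by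
  induction w generalizing n i with
  | nil => exact ⟨i, .refl _⟩
  | cons e w ih =>
    have he : IsTangle [e] n (n - e.ins + e.outs) := ⟨h.1, rfl⟩
    obtain ⟨j, hj⟩ := TIso.dot_up_piece he hi (by rintro j rfl; simpa using hw j)
    have ht : IsTangle [e, dot j] n (n - e.ins + e.outs) :=
      hj.isTangle_iff.1 (isTangle_dot.2 ⟨hi, he⟩)
    obtain ⟨k, hk⟩ := ih h.2 (isTangle_dot.1 ht.2).1 fun j => by have := hw j; simp_all
    exact ⟨k, (hj.append_right h.2).trans (hk.append_left he)⟩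

theorem TIso.dot_down {w : Word} {i n m : ℕ} (h : IsTangle w n m) (hi : i < m)
    (hw : ∀ j, cup j ∉ w) : ∃ j, TIso n m (w ++ [dot i]) (dot j :: w) := by
  induction w generalizing n with
  | nil => exact ⟨i, .refl _⟩
  | cons e w ih =>
    obtain ⟨k, hk⟩ := ih h.2 fun j => by have := hw j; simp_all
    have he : IsTangle [e] n (n - e.ins + e.outs) := ⟨h.1, rfl⟩
    have hk' : k < n - e.ins + e.outs := by
      have h' := hk.isTangle_iff.1 (h.2.append (isTangle_dot.2 ⟨hi, rfl⟩))
      exact (isTangle_dot.1 h').1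
    obtain ⟨j, hj⟩ := TIso.dot_down_piece he hk' (by rintro j rfl; simpa using hw j)
    exact ⟨j, (hk.append_left he).trans (hj.append_right h.2)⟩

/-- All dots of a diagram of the undotted tangle `l` can be moved to its ends. -/
def SlideOut (l : Word) : Prop :=
  ∀ n m D, eraseDots D = l → IsTangle D n m →
    ∃ d d', eraseDots d = [] ∧ eraseDots d' = [] ∧ TIso n m D (d ++ l ++ d')

theorem isTangle_of_eraseDots_eq_nil {d : Word} {n m : ℕ} (hd : eraseDots d = [])
    (h : IsTangle d n m) : n = m := by
  have := isTangle_eraseDots h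
  rwa [hd] at this

theorem TIso.exists_dots_up {l D : Word} {n m : ℕ} (hl : ∀ j, cap j ∉ l) (hD : eraseDots D = l)
    (ht : IsTangle D n m) : ∃ d', eraseDots d' = [] ∧ TIso n m D (l ++ d') := by
  induction D generalizing n l with
  | nil => subst hD; exact ⟨[], rfl, .refl _⟩
  | cons e D ih =>
    by_cases he : e.isDot
    · obtain ⟨i, rfl⟩ : ∃ i, e = dot i := by cases e <;> simp_all [isDot]
      rw [eraseDots_dot] at hD
      obtain ⟨h₁, h₂⟩ := isTangle_dot.1 ht
      obtain ⟨d', h₃, h₄⟩ := ih hl hD h₂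
      have hl' : IsTangle l n m := hD ▸ isTangle_eraseDots h₂
      obtain ⟨j, hj⟩ := TIso.dot_up hl' h₁ hl
      have hd' : IsTangle d' m m := by
        obtain ⟨k, h₅, h₆⟩ := isTangle_append.1 (h₄.isTangle_iff.1 h₂)
        rwa [h₅.unique hl'] at h₆
      refine ⟨dot j :: d', by simpa, ?_⟩
      have s₁ := h₄.append_left (p := [dot i]) (a := n) (isTangle_dot.2 ⟨h₁, rfl⟩)
      have s₂ := hj.append_right hd'
      simp only [List.cons_append, List.nil_append, List.append_assoc] at s₁ s₂
      exact s₁.trans s₂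
    · have hD' : e :: eraseDots D = l := by rw [← hD]; cases e <;> simp_all [isDot]
      subst hD'
      obtain ⟨d', h₃, h₄⟩ := ih (fun j => by have := hl j; simp_all) rfl ht.2
      exact ⟨d', h₃, h₄.append_left (p := [e]) ⟨ht.1, rfl⟩⟩

theorem slideOut_of_forall_ne_cap {l : Word} (hl : ∀ j, cap j ∉ l) : SlideOut l := by
  intro n m D hD ht
  obtain ⟨d', h₁, h₂⟩ := TIso.exists_dots_up hl hD ht
  exact ⟨[], d', rfl, h₁, h₂⟩

theorem slideOut_of_forall_ne_cup {l : Word} (hl : ∀ j, cup j ∉ l) : SlideOut l := by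
  intro n m D hD ht
  suffices ∃ d', eraseDots d' = [] ∧ TIso n m D (d' ++ l) by
    obtain ⟨d', h₁, h₂⟩ := this
    exact ⟨d', [], h₁, rfl, by simpa using h₂⟩
  induction D using List.reverseRecOn generalizing m l with
  | nil => subst hD; exact ⟨[], rfl, .refl _⟩
  | append_singleton D e ih =>
    obtain ⟨k, h₁, h₂⟩ := isTangle_append.1 ht
    by_cases he : e.isDot
    · obtain ⟨i, rfl⟩ : ∃ i, e = dot i := by cases e <;> simp_all [isDot]
      simp only [eraseDots_append, eraseDots_dot, eraseDots_nil, List.append_nil] at hD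
      obtain ⟨hi, rfl : k = m⟩ := isTangle_dot.1 h₂
      obtain ⟨d', h₃, h₄⟩ := ih hl k hD h₁
      have hl' : IsTangle l n k := hD ▸ isTangle_eraseDots h₁
      obtain ⟨j, hj⟩ := TIso.dot_down hl' hi hl
      have hd' : IsTangle d' n n := by
        obtain ⟨k', h₅, h₆⟩ := isTangle_append.1 (h₄.isTangle_iff.1 h₁)
        rwa [← isTangle_of_eraseDots_eq_nil h₃ h₅] at h₅
      refine ⟨d' ++ [dot j], by simpa, ?_⟩
      have s₁ := h₄.append_right h₂
      have s₂ := hj.append_left hd'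
      simp only [List.cons_append, List.nil_append, List.append_assoc] at s₁ s₂ ⊢
      exact s₁.trans s₂
    · have hD' : eraseDots D ++ [e] = l := by rw [← hD]; cases e <;> simp_all [isDot]
      subst hD'
      obtain ⟨d', h₃, h₄⟩ := ih (fun j => by have := hl j; simp_all) _ rfl h₁
      exact ⟨d', h₃, by simpa using h₄.append_right h₂⟩

theorem slideOut_cons {e : Piece} (he : e.isDot = false) {l : Word}
    (h : ∀ n m D, IsTangle [e] n m → ∀ k, eraseDots D = l → IsTangle D m k →
      ∃ d d', eraseDots d = [] ∧ eraseDots d' = [] ∧ TIso n k (e :: D) (d ++ e :: l ++ d')) :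
    SlideOut (e :: l) := by
  intro n m D hD ht
  induction D generalizing n with
  | nil => simp at hD
  | cons x D ih =>
    by_cases hx : x.isDot
    · obtain ⟨i, rfl⟩ : ∃ i, x = dot i := by cases x <;> simp_all [isDot]
      obtain ⟨h₁, h₂⟩ := isTangle_dot.1 ht
      obtain ⟨d, d', h₃, h₄, h₅⟩ := ih n (by simpa using hD) h₂
      exact ⟨dot i :: d, d', by simpa, h₄, h₅.append_left (p := [dot i]) (by simp; omega)⟩
    · have hD' : x :: eraseDots D = e :: l := by
        cases x <;> first | exact hD | exact absurd rfl hx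
      injection hD' with h₁ h₂
      subst h₁
      exact h n _ D ⟨ht.1, rfl⟩ m h₂ ht.2

theorem TIso.dot_dots {d : Word} {i n m : ℕ} (hd : eraseDots d = []) (h : IsTangle d n m)
    (hi : i < n) : TIso n m (d ++ [dot i]) (dot i :: d) := by
  induction d with
  | nil => exact .refl _
  | cons e d ih =>
    obtain ⟨j, rfl⟩ : ∃ j, e = dot j := by cases e <;> simp_all
    obtain ⟨h₁, h₂⟩ := isTangle_dot.1 h
    have hj : TIso n n [dot j, dot i] [dot i, dot j] := by
      rcases lt_trichotomy i j with hij | rfl | hij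
      · exact (TIso.dot_left (e := dot j) (by simp; omega) hij).symm
      · exact .refl _
      · exact TIso.dot_left (e := dot i) (by simp; omega) hij
    exact ((ih hd h₂).append_left (p := [dot j]) (isTangle_dot.2 ⟨h₁, rfl⟩)).trans
      (hj.append_right h₂)

/-- As `i ≠ j`, the minimum and the maximum do not close up to a circle. A dot between them either
avoids the maximum and goes up, or slides along the maximum to the strand that avoids the minimum
and goes down. -/
theorem slideOut_cup_cap {i j : ℕ} (hij : i ≠ j) : SlideOut [cup i, cap j] := by
  refine slideOut_cons rfl fun n m D he k hD ht => ?_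
  obtain ⟨hi, rfl : n + 2 = m⟩ := isTangle_cup.1 he
  obtain ⟨d, d', hd, hd', hiso⟩ := slideOut_of_forall_ne_cup (l := [cap j]) (by simp) _ _ D hD ht
  obtain ⟨k₁, ht₁, ht₂⟩ := isTangle_append.1 (hiso.isTangle_iff.1 ht)
  obtain rfl := isTangle_of_eraseDots_eq_nil hd' ht₂
  suffices ∃ a a', eraseDots a = [] ∧ eraseDots a' = [] ∧
      TIso n k₁ (cup i :: (d ++ [cap j])) (a ++ [cup i, cap j] ++ a') by
    obtain ⟨a, a', ha, ha', hiso'⟩ := this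
    refine ⟨a, a' ++ d', ha, by simp [ha', hd'], ?_⟩
    have s₁ := hiso.append_left (p := [cup i]) he
    have s₂ := hiso'.append_right ht₂
    simp only [List.cons_append, List.nil_append, List.append_assoc] at s₁ s₂ ⊢
    exact s₁.trans s₂
  clear hiso ht₂ hd' ht hD
  induction d using List.reverseRecOn with
  | nil => exact ⟨[], [], rfl, rfl, .refl _⟩
  | append_singleton d e ih =>
    obtain ⟨x, rfl⟩ : ∃ x, e = dot x := by cases e <;> simp_all
    simp only [eraseDots_append, eraseDots_dot, eraseDots_nil, List.append_nil] at hd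
    rw [List.append_assoc, isTangle_append] at ht₁
    obtain ⟨k₂, h₁, h₂⟩ := ht₁
    obtain rfl := isTangle_of_eraseDots_eq_nil hd h₁
    obtain ⟨hx, h₂⟩ := isTangle_dot.1 h₂
    obtain ⟨a, a', ha, ha', hiso⟩ := ih hd (h₁.append h₂)
    have hp : IsTangle (cup i :: d) n (n + 2) := IsTangle.append (u := [cup i]) he h₁
    obtain ⟨hj, hk⟩ := isTangle_cap.1 h₂
    by_cases hxj : x ≠ j ∧ x ≠ j + 1
    · obtain ⟨y, hy⟩ := TIso.dot_up_piece h₂ hx (by rintro j' h; cases h; exact hxj)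
      have hy' := hy.isTangle_iff.1 (isTangle_dot.2 ⟨hx, h₂⟩)
      have hq : IsTangle [dot y] k₁ k₁ := by
        obtain ⟨k₃, h₃, h₄⟩ := (isTangle_append (u := [cap j]) (v := [dot y])).1 hy'
        obtain rfl := h₂.unique h₃
        exact h₄
      refine ⟨a, a' ++ [dot y], ha, by simp [ha'], ?_⟩
      have s₁ := hy.append_left hp
      have s₂ := hiso.append_right hq
      simp only [List.cons_append, List.nil_append, List.append_assoc] at s₁ s₂ ⊢
      exact s₁.trans s₂
    -- Of the two strands of the maximum, the right one misses the minimum if `i < j` and the left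
    -- one if `j < i`.
    · obtain ⟨x', hx', hx'n, hx'i⟩ : ∃ x', TIso (n + 2) k₁ [dot x, cap j] [dot x', cap j] ∧
          x' < n + 2 ∧ x' ≠ i ∧ x' ≠ i + 1 := by
        have hm := TIso.of_move (n := n + 2) (m := k₁) [] [] (Move.dotCap j)
          (isTangle_dot.2 ⟨by omega, h₂⟩) (isTangle_dot.2 ⟨by omega, h₂⟩)
        rcases lt_or_gt_of_ne hij with h | h
        · refine ⟨j + 1, ?_, by omega, by omega, by omega⟩
          rcases (by omega : x = j ∨ x = j + 1) with rfl | rfl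
          · exact hm
          · exact .refl _
        · refine ⟨j, ?_, by omega, by omega, by omega⟩
          rcases (by omega : x = j ∨ x = j + 1) with rfl | rfl
          · exact .refl _
          · exact hm.symm
      obtain ⟨y, hy⟩ := TIso.dot_down_piece he hx'n (by rintro j' h; cases h; exact hx'i)
      have hy' := hy.isTangle_iff.1 (he.append (v := [dot x']) (isTangle_dot.2 ⟨hx'n, rfl⟩))
      refine ⟨dot y :: a, a', by simpa, ha', ?_⟩
      have s₁ := hx'.append_left hp
      have s₂ := (TIso.dot_dots hd h₁ hx'n).append he h₂
      have s₃ := hy.append_right (h₁.append h₂)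
      have s₄ := hiso.append_left (p := [dot y]) (a := n)
        (isTangle_dot.2 ⟨(isTangle_dot.1 hy').1, rfl⟩)
      simp only [List.cons_append, List.nil_append, List.append_assoc] at s₁ s₂ s₃ s₄ ⊢
      exact s₁.trans (s₂.trans (s₃.trans s₄))

/-- Used for both sides of an exchange of heights. The excluded pair is a closed circle, the one
case in which a dot is trapped. -/
theorem slideOut_pair {e e' : Piece} (he : e.isDot = false) (he' : e'.isDot = false)
    (h : ∀ i, e = cup i → e' ≠ cap i) : SlideOut [e, e'] := by
  cases e with
  | dot i => simp [isDot] at he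
  | cap i =>
    refine slideOut_cons rfl fun n m D hc k hD ht => ?_
    by_cases hcap : ∃ j, e' = cap j
    · obtain ⟨j, rfl⟩ := hcap
      refine slideOut_of_forall_ne_cup (l := [cap i, cap j]) (by simp) n k (cap i :: D)
        (by simp [hD]) (IsTangle.append (u := [cap i]) hc ht)
    · obtain ⟨d', hd', hiso⟩ :=
        TIso.exists_dots_up (l := [e']) (by simpa [eq_comm] using hcap) hD ht
      exact ⟨[], d', rfl, hd', hiso.append_left (p := [cap i]) hc⟩
  | cup i =>
    by_cases hcap : ∃ j, e' = cap j
    · obtain ⟨j, rfl⟩ := hcap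
      exact slideOut_cup_cap (by rintro rfl; exact h i rfl rfl)
    · exact slideOut_of_forall_ne_cap (by simpa [eq_comm] using hcap)
  | cross i b =>
    by_cases hcap : ∃ j, e' = cap j
    · obtain ⟨j, rfl⟩ := hcap
      exact slideOut_of_forall_ne_cup (by simp)
    · exact slideOut_of_forall_ne_cap (by simpa [eq_comm] using hcap)

/-! ### Isotopies carry dots along -/

/-- Every dotted diagram of the tangle `l` is isotopic to a dotted diagram of the tangle `r`. -/
def Lifts (l r : Word) : Prop :=
  ∀ n m D, IsTangle l n m → IsTangle r n m → eraseDots D = eraseDots l → IsTangle D n m →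
    ∃ D', eraseDots D' = eraseDots r ∧ TIso n m D D'

theorem Lifts.of_eraseDots_eq {l r : Word} (h : eraseDots l = eraseDots r) : Lifts l r :=
  fun _ _ D _ _ hD _ => ⟨D, hD.trans h, .refl _⟩

/-- Once the dots are at the ends, the undotted move takes place between them. -/
theorem Lifts.of_slideOut {l r : Word} (h : ∀ n m, IsTangle l n m → IsTangle r n m → TIso n m l r)
    (hl : SlideOut l) (hl' : eraseDots l = l) : Lifts l r := by
  intro n m D ht ht' hD htD
  obtain ⟨d, d', hd, hd', hiso⟩ := hl n m D (hD.trans hl') htD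
  obtain ⟨k, h₁, h₂⟩ := isTangle_append.1 (hiso.isTangle_iff.1 htD)
  obtain ⟨k', h₁, h₃⟩ := isTangle_append.1 h₁
  obtain rfl := isTangle_of_eraseDots_eq_nil hd h₁
  obtain rfl := isTangle_of_eraseDots_eq_nil hd' h₂
  exact ⟨d ++ r ++ d', by simp [hd, hd'], hiso.trans ((h _ _ ht ht').append h₁ h₂)⟩

theorem isDot_moveTo (e : Piece) (j : ℕ) : (e.moveTo j).isDot = e.isDot := by cases e <;> rfl

theorem eraseDots_cons {e : Piece} (he : e.isDot = false) (w : Word) :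
    eraseDots (e :: w) = e :: eraseDots w := by
  simp [eraseDots, he]

theorem IsTangle.unique_left {w : Word} {n n' m : ℕ} (h : IsTangle w n m) (h' : IsTangle w n' m) :
    n = n' := by
  induction w generalizing n n' with
  | nil => exact Eq.trans h (Eq.symm h')
  | cons e w ih =>
    have := ih h.2 h'.2
    have h₁ := h.1
    have h₂ := h'.1
    omega

/-- Moves that involve dots do not change the erased diagram, so there is nothing to carry along. On
each side of every other move all dots can be slid to the ends. -/
theorem Move.lifts {l r : Word} (h : Move l r) : Lifts l r ∧ Lifts r l := by
  have hiso : ∀ n m, IsTangle l n m → IsTangle r n m → TIso n m l r := fun n m h₁ h₂ => by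
    have := TIso.of_move (n := n) (m := m) [] [] h (by simpa using h₁) (by simpa using h₂)
    simpa using this
  have hiso' : ∀ n m, IsTangle r n m → IsTangle l n m → TIso n m r l :=
    fun n m h₁ h₂ => (hiso n m h₂ h₁).symm
  have main : SlideOut l → SlideOut r → eraseDots l = l → eraseDots r = r →
      Lifts l r ∧ Lifts r l :=
    fun h₁ h₂ h₃ h₄ => ⟨.of_slideOut hiso h₁ h₃, .of_slideOut hiso' h₂ h₄⟩
  have dots : eraseDots l = eraseDots r → Lifts l r ∧ Lifts r l :=
    fun h => ⟨.of_eraseDots_eq h, .of_eraseDots_eq h.symm⟩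
  have hnil : SlideOut [] := slideOut_of_forall_ne_cap (by simp)
  cases h with
  | exchange g h hgh =>
    by_cases hg : g.isDot
    · obtain ⟨i, rfl⟩ : ∃ i, g = dot i := by cases g <;> simp_all [isDot]
      apply dots
      cases h <;> simp [moveTo]
    by_cases hh : h.isDot
    · obtain ⟨i, rfl⟩ : ∃ i, h = dot i := by cases h <;> simp_all [isDot]
      apply dots
      have : g.moveTo (g.pos - (dot i).ins + (dot i).outs) = g := by
        have : g.pos - (dot i).ins + (dot i).outs = g.pos := by
          simp only [pos, ins, outs] at hgh ⊢; omega
        rw [this]; cases g <;> rfl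
      rw [this]
      cases g <;> simp
    · simp only [Bool.not_eq_true] at hg hh
      apply main
      · refine slideOut_pair hg hh ?_
        rintro i rfl rfl
        simp [pos, ins] at hgh
      · refine slideOut_pair hh (by rw [isDot_moveTo, hg]) ?_
        rintro i rfl h
        cases g with
        | cap j =>
          simp only [moveTo, pos, ins, outs, cap.injEq] at h hgh
          omega
        | _ => simp [moveTo] at h
      · rw [eraseDots_cons hg, eraseDots_cons hh, eraseDots_nil]
      · rw [eraseDots_cons hh, eraseDots_cons (by rw [isDot_moveTo, hg]), eraseDots_nil]
  | zigzagLeft i =>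
    exact main (slideOut_cup_cap (by omega)) hnil (by simp) rfl
  | zigzagRight i => exact main (slideOut_cup_cap (by omega)) hnil (by simp) rfl
  | pivotCap i b =>
    exact main (slideOut_of_forall_ne_cup (by simp)) (slideOut_of_forall_ne_cup (by simp))
      (by simp) (by simp)
  | pivotCup i b =>
    exact main (slideOut_of_forall_ne_cap (by simp)) (slideOut_of_forall_ne_cap (by simp))
      (by simp) (by simp)
  | reidemeisterOneCap i b =>
    exact main (slideOut_of_forall_ne_cup (by simp)) (slideOut_of_forall_ne_cup (by simp))
      (by simp) (by simp)
  | reidemeisterOneCup i b =>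
    exact main (slideOut_of_forall_ne_cap (by simp)) (slideOut_of_forall_ne_cap (by simp))
      (by simp) (by simp)
  | reidemeisterTwo i b => exact main (slideOut_of_forall_ne_cap (by simp)) hnil (by simp) rfl
  | reidemeisterThree i b c d h =>
    exact main (slideOut_of_forall_ne_cap (by simp)) (slideOut_of_forall_ne_cap (by simp))
      (by simp) (by simp)
  | dotCrossLeft i b => exact dots (by simp)
  | dotCrossRight i b => exact dots (by simp)
  | dotCup i => exact dots (by simp)
  | dotCap i => exact dots (by simp)
  | dotDot i => exact dots (by simp)

/-! ### Parity of the number of dots. -/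

theorem numDots_append (u v : Word) : numDots (u ++ v) = numDots u + numDots v :=
  List.countP_append

@[simp] theorem numDots_nil : numDots [] = 0 := rfl
@[simp] theorem numDots_cup (i : ℕ) (w : Word) : numDots (cup i :: w) = numDots w := by
  simp [numDots, isDot]
@[simp] theorem numDots_cap (i : ℕ) (w : Word) : numDots (cap i :: w) = numDots w := by
  simp [numDots, isDot]
@[simp] theorem numDots_cross (i : ℕ) (b : Bool) (w : Word) :
    numDots (cross i b :: w) = numDots w := by
  simp [numDots, isDot]
@[simp] theorem numDots_dot (i : ℕ) (w : Word) : numDots (dot i :: w) = numDots w + 1 := by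
  simp [numDots, List.countP_cons, isDot]

theorem Move.even_numDots_iff {l r : Word} (h : Move l r) : Even (numDots l) ↔ Even (numDots r) := by
  cases h with
  | exchange g h hgh => cases g <;> cases h <;> simp [moveTo]
  | dotDot i => simp [parity_simps]
  | _ => simp

theorem Isotopic.even_numDots_iff {w w' : Word} (h : Isotopic w w') :
    Even (numDots w) ↔ Even (numDots w') := by
  induction h with
  | rel _ _ h =>
    obtain ⟨u, v, l, r, hm, -, -⟩ := h
    simp only [numDots_append, Nat.even_add, hm.even_numDots_iff]
  | refl => rfl
  | symm _ _ _ ih => exact ih.symm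
  | trans _ _ _ _ _ ih₁ ih₂ => exact ih₁.trans ih₂

theorem Isotopic.isTwoFoldMarked_iff {w w' : Word} (h : Isotopic w w') :
    IsTwoFoldMarked w ↔ IsTwoFoldMarked w' :=
  and_congr h.isDiagram_iff h.even_numDots_iff

theorem IsTQA.isTwoFoldMarked {w : Word} (h : IsTQA w) : IsTwoFoldMarked w := by
  induction h with
  | unknot => exact ⟨by simp [IsDiagram], by simp⟩
  | split u v hu hv =>
    exact ⟨hu.1.append hv.1, by rw [numDots_append]; exact hu.2.add_odd hv.2⟩
  | skein _ _ _ _ hw => exact hw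
  | isotopic _ _ _ h ih => exact h.isTwoFoldMarked_iff.1 ih

/-! ### Links that are TQA for every marking -/

/-- Every two-fold marking makes the underlying link two-fold quasi-alternating. -/
def AllTQA (w : Word) : Prop :=
  ∀ D, IsDiagram D → eraseDots D = eraseDots w → Even (numDots D) → IsTQA D

theorem AllTQA.of_lifts {u v l r : Word} (h : Lifts r l) (hl : IsDiagram (u ++ l ++ v))
    (hr : IsDiagram (u ++ r ++ v)) (H : AllTQA (u ++ l ++ v)) : AllTQA (u ++ r ++ v) := by
  intro D hD hDe hDn
  simp only [eraseDots_append] at hDe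
  obtain ⟨D', Dv, rfl, hD', hDv⟩ := List.filter_eq_append_iff.1 hDe
  obtain ⟨Du, Dr, rfl, hDu, hDr⟩ := List.filter_eq_append_iff.1 hD'
  obtain ⟨m, hDur, htv⟩ := isTangle_append.1 hD
  obtain ⟨n, htu, htr⟩ := isTangle_append.1 hDur
  obtain ⟨m₁, h₁, hv₁⟩ := isTangle_append.1 hr
  obtain ⟨n₁, hu₁, hr₁⟩ := isTangle_append.1 h₁
  obtain ⟨m₂, h₂, hv₂⟩ := isTangle_append.1 hl
  obtain ⟨n₂, hu₂, hl₂⟩ := isTangle_append.1 h₂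
  -- Dots do not affect the number of strands, so the cuts of the dotted and of the undotted diagram
  -- have equal widths.
  obtain rfl : n₁ = n := (isTangle_eraseDots hu₁).unique (hDu ▸ isTangle_eraseDots htu)
  obtain rfl : m₁ = m := (isTangle_eraseDots hr₁).unique (hDr ▸ isTangle_eraseDots htr)
  obtain rfl : n₁ = n₂ := hu₁.unique hu₂
  obtain rfl : m₁ = m₂ := hv₁.unique_left hv₂
  obtain ⟨Dl, hDl, hiso⟩ := h _ _ Dr hr₁ hl₂ hDr htr
  have hI := (hiso.append htu htv).isotopic
  exact .isotopic _ _ (H _ (hI.isDiagram_iff.1 hD)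
    (by simp only [eraseDots_append, hDl]; rw [← hDu, ← hDv]; rfl)
    (hI.even_numDots_iff.1 hDn)) (hI.symm)

theorem Isotopic.allTQA_iff {w w' : Word} (h : Isotopic w w') : AllTQA w ↔ AllTQA w' := by
  induction h with
  | rel _ _ h =>
    obtain ⟨u, v, l, r, hm, h₁, h₂⟩ := h
    exact ⟨.of_lifts hm.lifts.2 h₁ h₂, .of_lifts hm.lifts.1 h₂ h₁⟩
  | refl => rfl
  | symm _ _ _ ih => exact ih.symm
  | trans _ _ _ _ _ ih₁ ih₂ => exact ih₁.trans ih₂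

theorem isDiagram_of_cross {u v : Word} {i : ℕ} {b : Bool} (h : IsDiagram (u ++ [cross i b] ++ v)) :
    IsDiagram (u ++ v) ∧ IsDiagram (u ++ [cap i, cup i] ++ v) := by
  rw [IsDiagram, List.append_assoc, isTangle_append] at h
  obtain ⟨n, h₁, h₂⟩ := h
  obtain ⟨h₂, h₃⟩ := isTangle_cross.1 h₂
  refine ⟨h₁.append h₃, (h₁.append (k := n) ?_).append h₃⟩
  simp; omega

/-- A property of diagrams that depends only on the marked link and can be proved by resolving
crossings. -/
structure SkeinClosed (P : Word → Prop) : Prop where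
  isotopic : ∀ {w w'}, Isotopic w w' → P w → P w'
  skein : ∀ {u v i b}, IsDiagram (u ++ [cross i b] ++ v) → P (u ++ v) →
    P (u ++ [cap i, cup i] ++ v) →
    linkDet (u ++ [cross i b] ++ v) = linkDet (u ++ v) + linkDet (u ++ [cap i, cup i] ++ v) →
    P (u ++ [cross i b] ++ v)

theorem skeinClosed_isTQA : SkeinClosed IsTQA where
  isotopic h hw := .isotopic _ _ hw h
  skein hd h₁ h₂ h :=
    .skein _ _ _ _ ⟨hd, by simpa [numDots_append] using h₁.isTwoFoldMarked.2⟩ h₁ h₂ h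

/-- Invariance is the lifting of isotopies to dotted diagrams. For the skein step, any dots on the
diagram remain on both smoothings with the same parity, and determinants ignore dots. -/
theorem skeinClosed_allTQA : SkeinClosed AllTQA where
  isotopic h hw := h.allTQA_iff.1 hw
  skein := by
    intro u v i b hd h₁ h₂ h D hD hDe hDn
    simp only [eraseDots_append, eraseDots_cross, List.append_assoc,
      List.cons_append, List.nil_append] at hDe
    obtain ⟨Du, D', rfl, hDu, hD'⟩ := List.filter_eq_append_iff.1 hDe
    obtain ⟨d, Dv, rfl, hd', -, hDv⟩ := List.filter_eq_cons_iff.1 hD'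
    have hU : eraseDots (Du ++ d) = eraseDots u := by
      rw [eraseDots_append]
      have : eraseDots d = [] := List.filter_eq_nil_iff.2 hd'
      rw [this, List.append_nil]
      exact hDu
    have hV : eraseDots Dv = eraseDots v := hDv
    have e : Du ++ (d ++ cross i b :: Dv) = Du ++ d ++ [cross i b] ++ Dv := by simp
    rw [e] at hD hDn ⊢
    generalize Du ++ d = U at *
    obtain ⟨hD₁, hD₂⟩ := isDiagram_of_cross hD
    obtain ⟨hd₁, hd₂⟩ := isDiagram_of_cross hd
    refine .skein _ _ _ _ ⟨hD, hDn⟩ (h₁ _ hD₁ (by simp [hU, hV]) ?_)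
      (h₂ _ hD₂ (by simp [hU, hV]) ?_) ?_
    · simpa [numDots_append] using hDn
    · simpa [numDots_append] using hDn
    · rw [← linkDet_eraseDots hD, ← linkDet_eraseDots hD₁, ← linkDet_eraseDots hD₂]
      rw [← linkDet_eraseDots hd, ← linkDet_eraseDots hd₁, ← linkDet_eraseDots hd₂] at h
      simpa [hU, hV] using h

/-! ### Markings of knots -/

/-- The diagram with a further dot at the given point. -/
def insertDot (w : Word) (p : ℕ × ℕ) : Word := w.take p.1 ++ [dot p.2] ++ w.drop p.1

theorem isotopic_insertDot_of_joined {w : Word} (hw : IsDiagram w) {p q : ℕ × ℕ}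
    (hp : p.2 < width (w.take p.1)) (h : Joined w p q) :
    Isotopic (insertDot w p) (insertDot w q) := by
  have split : ∀ {k e}, w[k]? = some e → ∃ n n', n = width (w.take k) ∧ IsTangle (w.take k) 0 n ∧
      IsTangle [e] n n' ∧ IsTangle (w.drop (k + 1)) n' 0 ∧
      w.take (k + 1) = w.take k ++ [e] ∧ w.drop k = e :: w.drop (k + 1) := by
    intro k e he
    obtain ⟨hk, rfl⟩ := List.getElem?_eq_some_iff.1 he
    have hd := List.drop_eq_getElem_cons hk
    have ht : w.take (k + 1) = w.take k ++ [w[k]] := by simp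
    rw [IsDiagram, ← List.take_append_drop k w, isTangle_append, hd] at hw
    obtain ⟨n, h₁, h₂⟩ := hw
    exact ⟨n, _, h₁.width_eq.symm, h₁, ⟨h₂.1, rfl⟩, h₂.2, ht, hd⟩
  -- a dot below the piece `e` moves to a point above it
  have up : ∀ {k e i j}, w[k]? = some e →
      (∀ n n', n = width (w.take k) → IsTangle [e] n n' → TIso n n' [dot i, e] [e, dot j]) →
      Isotopic (insertDot w (k, i)) (insertDot w (k + 1, j)) := by
    intro k e i j he h
    obtain ⟨n, n', hn, h₁, h₂, h₃, h₄, h₅⟩ := split he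
    have := ((h n n' hn h₂).append h₁ h₃).isotopic
    simpa [insertDot, h₄, h₅] using this
  cases h with
  | left k e he i hi => exact up he fun n n' _ h => TIso.dot_left h hi
  | right k e he i =>
    refine up he fun n n' hn h => ?_
    have := TIso.dot_right (i := e.pos + e.ins + i) h (by omega) (by subst hn; exact hp)
    rwa [show e.pos + e.ins + i - e.ins + e.outs = e.pos + e.outs + i by omega] at this
  | cup k i he =>
    obtain ⟨n, n', hn, h₁, h₂, h₃, h₄, h₅⟩ := split he
    have := ((TIso.of_move (n := n) (m := n + 2) [] [] (Move.dotCup i)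
      (by simp at h₂ ⊢; omega) (by simp at h₂ ⊢; omega)).append h₁ (q := w.drop (k + 1)) (b := 0)
      (by rwa [(isTangle_cup.1 h₂).2])).isotopic
    simpa [insertDot, h₄, h₅] using this
  | cap k i he =>
    obtain ⟨n, n', hn, h₁, h₂, h₃, h₄, h₅⟩ := split he
    have := ((TIso.of_move (n := n) (m := n') [] [] (Move.dotCap i)
      (by simp at h₂ ⊢; omega) (by simp at h₂ ⊢; omega)).append h₁ h₃).isotopic
    simpa [insertDot, h₄, h₅] using this
  | crossUp k i b he =>
    refine up he fun n n' hn h => TIso.of_move [] [] (Move.dotCrossLeft i b) ?_ ?_ <;>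
      simp at h ⊢ <;> omega
  | crossDown k i b he =>
    refine up he fun n n' hn h => TIso.of_move [] [] (Move.dotCrossRight i b) ?_ ?_ <;>
      simp at h ⊢ <;> omega
  | dot k i he => exact up he fun n n' _ _ => .refl _

theorem isotopic_insertDot {w : Word} (hw : IsDiagram w) (h : numComponents w = 1)
    (p q : Point w) : Isotopic (insertDot w p.1) (insertDot w q.1) := by
  obtain ⟨hs, -⟩ := Nat.card_eq_one_iff_unique.1 h
  have := Quot.eqvGen_exact (hs.elim (Quot.mk _ p) (Quot.mk _ q))
  clear h hs
  induction this with
  | rel p q h => exact isotopic_insertDot_of_joined hw p.2.2 h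
  | refl => exact Relation.EqvGen.refl _
  | symm _ _ _ ih => exact Relation.EqvGen.symm _ _ ih
  | trans _ _ _ _ _ ih₁ ih₂ => exact Relation.EqvGen.trans _ _ _ ih₁ ih₂

theorem exists_eq_append_dot {w : Word} (h : numDots w ≠ 0) :
    ∃ u i v, w = u ++ dot i :: v := by
  obtain ⟨e, he, hd⟩ := List.countP_pos_iff.1 (Nat.pos_of_ne_zero h)
  obtain ⟨u, v, rfl⟩ := List.append_of_mem he
  cases e with
  | dot i => exact ⟨u, i, v, rfl⟩
  | _ => simp [isDot] at hd

/-- An even number of dots on a knot can be removed. -/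
theorem isotopic_eraseDots {D : Word} (hD : IsDiagram D) (h : numComponents D = 1)
    (hn : Even (numDots D)) : Isotopic D (eraseDots D) := by
  induction hk : numDots D using Nat.strong_induction_on generalizing D with
  | _ k ih =>
    subst hk
    by_cases h₀ : numDots D = 0
    · have : eraseDots D = D := by
        refine List.filter_eq_self.2 fun e he => ?_
        have := List.countP_eq_zero.1 h₀ e he
        simpa using this
      rw [this]
      exact Relation.EqvGen.refl _
    obtain ⟨u, i, v, rfl⟩ := exists_eq_append_dot h₀
    -- The number of dots is even, so removing one leaves another.
    have h₁ : numDots (u ++ v) ≠ 0 := by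
      intro h'
      rw [numDots_append, numDots_dot] at hn
      rw [numDots_append] at h'
      rw [← add_assoc, h'] at hn
      simp at hn
    obtain ⟨n, hu, hv⟩ := isTangle_append.1 hD
    obtain ⟨hi, hv⟩ := isTangle_dot.1 hv
    have huv : IsDiagram (u ++ v) := hu.append hv
    have he : eraseDots (u ++ v) = eraseDots (u ++ dot i :: v) := by simp
    obtain ⟨x, j, y, hxy⟩ := exists_eq_append_dot h₁
    obtain ⟨m, hx, hy⟩ := isTangle_append.1 (hxy ▸ huv : IsDiagram (x ++ dot j :: y))
    obtain ⟨hj, hy⟩ := isTangle_dot.1 hy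
    have hxy' : IsDiagram (x ++ y) := hx.append hy
    have he' : eraseDots (x ++ y) = eraseDots (u ++ dot i :: v) := by rw [← he, hxy]; simp
    have hc : numComponents (u ++ v) = 1 := by
      rw [← numComponents_eraseDots huv, he, numComponents_eraseDots hD, h]
    have hc' : numComponents (x ++ y) = 1 := by
      rw [← numComponents_eraseDots hxy', he', numComponents_eraseDots hD, h]
    -- The first dot is moved along the knot to a place next to the second, where the two cancel.
    have s₁ := isotopic_insertDot huv hc ⟨(u.length, i), by simp, by simp [hu.width_eq]; omega⟩
      ⟨(x.length, j), by rw [hxy]; simp, by simp [hxy, hx.width_eq]; omega⟩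
    have s₂ := (TIso.of_move (n := 0) (m := 0) x y (Move.dotDot j)
      ((hx.append (by simp; omega)).append hy) (by rw [List.append_nil]; exact hxy')).isotopic
    have hnum : numDots (x ++ y) + 2 = numDots (u ++ dot i :: v) := by
      have := congrArg numDots hxy
      simp only [numDots_append, numDots_dot] at this ⊢
      omega
    have s₃ := ih (numDots (x ++ y)) (by omega) hxy' hc' (by
      rw [← hnum] at hn; simpa [parity_simps] using hn) rfl
    rw [he'] at s₃
    rw [show insertDot (u ++ v) (u.length, i) = u ++ dot i :: v by simp [insertDot],
      show insertDot (u ++ v) (x.length, j) = x ++ [dot j, dot j] ++ y by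
        rw [hxy]; simp [insertDot]] at s₁
    rw [List.append_nil] at s₂
    exact s₁.trans (s₂.trans s₃)

theorem allTQA_unknot : AllTQA [cup 0, cap 0] := by
  intro D hD hDe hDn
  have hd : IsDiagram [cup 0, cap 0] := by simp [IsDiagram]
  have h₁ : numComponents [cup 0, cap 0] = 1 := by
    apply Nat.pow_right_injective le_rfl
    simp only [two_pow_numComponents hd]
    rw [numColorings_circle, numColorings]
  simp only [eraseDots_cup, eraseDots_cap, eraseDots_nil] at hDe
  have h₂ : numComponents D = 1 := by rw [← numComponents_eraseDots hD, hDe, h₁]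
  have := isotopic_eraseDots hD h₂ hDn
  rw [hDe] at this
  exact .isotopic _ _ .unknot (this.symm)

/-! ### Rational tangles -/

/-- The operations that build the rational tangles: a crossing is added on the top or on a side. -/
inductive Op : Type
  | top
  | side

/-- A crossing of sign `b` is added on the right if it is positive and on the left if it is
negative. -/
def addSide (b : Bool) (T : Word) : Word :=
  if b then hsum T [cross 0 b] else hsum [cross 0 b] T

/-- The rational tangle built from a crossing by a sequence of operations, the last one first. -/
def tan (b : Bool) : List Op → Word
  | [] => [cross 0 b]
  | .top :: l => tan b l ++ [cross 0 b]
  | .side :: l => addSide b (tan b l)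

/-- The inverse of the rational number of a positive rational tangle. -/
noncomputable def slope : List Op → ℝ
  | [] => 1
  | .top :: l => slope l / (slope l + 1)
  | .side :: l => slope l + 1

theorem slope_pos (l : List Op) : 0 < slope l := by
  induction l with
  | nil => exact one_pos
  | cons o l ih => cases o <;> simp only [slope] <;> positivity

theorem isTangle_cross_two (b : Bool) : IsTangle [cross 0 b] 2 2 := by simp

theorem isTangle_addSide {T : Word} (hT : IsTangle T 2 2) (b : Bool) :
    IsTangle (addSide b T) 2 2 := by
  cases b
  · exact isTangle_hsum (isTangle_cross_two _) hT
  · exact isTangle_hsum hT (isTangle_cross_two _)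

theorem isTangle_tan (b : Bool) (l : List Op) : IsTangle (tan b l) 2 2 := by
  induction l with
  | nil => exact isTangle_cross_two b
  | cons o l ih =>
    cases o
    · exact ih.append (isTangle_cross_two b)
    · exact isTangle_addSide ih b

theorem eraseDots_hsum (T S : Word) : eraseDots (hsum T S) = hsum (eraseDots T) (eraseDots S) := by
  simp [hsum]

theorem eraseDots_tan (b : Bool) (l : List Op) : eraseDots (tan b l) = tan b l := by
  induction l with
  | nil => rfl
  | cons o l ih => cases o <;> cases b <;> simp [tan, addSide, eraseDots_hsum, ih]

theorem addSide_nil (b : Bool) : TIso 2 2 (addSide b []) [] := by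
  cases b
  · exact hsum_cross_nil _
  · exact hsum_nil_cross _

theorem addSide_horiz (b : Bool) : TIso 2 2 (addSide b horiz) [cross 0 b] := by
  cases b
  · exact hsum_horiz_right (isTangle_cross_two _)
  · exact hsum_horiz_left (isTangle_cross_two _)

theorem Evals.addSide {T : Word} {x y : ℂ} (h : Evals T x y) (hT : IsTangle T 2 2) (b : Bool) :
    Evals (addSide b T) (x * hcoeff b + y * vcoeff b) (y * hcoeff b) := by
  cases b
  · rw [show x * hcoeff false + y * vcoeff false = vcoeff false * y + hcoeff false * x by ring,
      mul_comm y]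
    exact (evals_cross false).hsum h hT
  · exact h.hsum (evals_cross true) (isTangle_cross_two _)

theorem HasSlope.addSide {T : Word} {ρ : ℝ} (h : HasSlope T ρ) (hT : IsTangle T 2 2) (b : Bool) :
    HasSlope (addSide b T) (ρ + sgn b) := by
  cases b
  · rw [add_comm]; exact (hasSlope_cross false).hsum h hT
  · exact h.hsum (hasSlope_cross true) (isTangle_cross_two _)

theorem hasSlope_tan (b : Bool) (l : List Op) : HasSlope (tan b l) (sgn b * slope l) := by
  have hs : sgn b ≠ 0 := by cases b <;> simp [sgn]
  induction l with
  | nil => rw [slope, mul_one]; exact hasSlope_cross b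
  | cons o l ih =>
    have := slope_pos l
    cases o
    · have h := ih.append (hasSlope_cross b) (isTangle_cross_two b) (by
        rw [← mul_add_one]; exact mul_ne_zero hs (by positivity))
      rw [show sgn b * slope (.top :: l) = sgn b * slope l * sgn b / (sgn b * slope l + sgn b) by
        simp only [slope]; field_simp]
      exact h
    · rw [show sgn b * slope (.side :: l) = sgn b * slope l + sgn b by simp only [slope]; ring]
      exact ih.addSide (isTangle_tan b l) b

/-- The context of `T` in `addSide b T`. -/
def Context.side (C : Context) (b : Bool) : Context :=
  if b then C.left [cross 0 b] (isTangle_cross_two b) else C.right [cross 0 b] (isTangle_cross_two b)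

@[simp] theorem Context.plug_side (C : Context) (b : Bool) (T : Word) :
    (C.side b).plug T = C.plug (addSide b T) := by
  cases b <;> simp [side, addSide]

/-! ### Resolving the crossings of a rational tangle -/

namespace SkeinClosed

variable {P : Word → Prop}

theorem plug_congr (hP : SkeinClosed P)
    (C : Context) {T T' : Word} (h : TIso 2 2 T T') (hT : P (C.plug T)) :
    P (C.plug T') := hP.isotopic (C.isotopic_plug h) hT

/-- With `vcoeff b = hcoeff b * i * sgn b`, both terms of the skein relation are nonnegative
multiples of one complex number, so their absolute values add up. All other determinant conditions
are reduced to this one. -/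
theorem plug_cross (hP : SkeinClosed P) (C : Context) {b : Bool} {σ : ℝ} (hσ : 0 ≤ σ)
    (h : br (C.plug horiz) = sgn b * σ * Complex.I * br (C.plug []))
    (h₁ : P (C.plug [])) (h₂ : P (C.plug horiz)) : P (C.plug [cross 0 b]) := by
  have e : C.plug [cross 0 b] = C.lower ++ [cross C.off b] ++ C.upper := by simp [Context.plug]
  have e₁ : C.plug [] = C.lower ++ C.upper := by simp [Context.plug]
  have e₂ : C.plug horiz = C.lower ++ [cap C.off, cup C.off] ++ C.upper := by simp [Context.plug]
  have hd := C.isDiagram_plug (isTangle_cross_two b)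
  have hdet : linkDet (C.plug [cross 0 b]) = linkDet (C.plug []) + linkDet (C.plug horiz) := by
    simp only [linkDet_eq]
    have hs : ‖(sgn b : ℂ)‖ = 1 := by cases b <;> simp [sgn]
    rw [evals_cross b C, h, vcoeff_eq,
      show hcoeff b * Complex.I * sgn b * br (C.plug []) +
        hcoeff b * (sgn b * σ * Complex.I * br (C.plug [])) =
        hcoeff b * Complex.I * sgn b * br (C.plug []) * ((1 + σ : ℝ) : ℂ) by push_cast; ring]
    simp only [norm_mul, norm_hcoeff, Complex.norm_I, hs, Complex.norm_real,
      Real.norm_of_nonneg hσ, Real.norm_of_nonneg (by positivity : 0 ≤ 1 + σ)]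
    ring
  rw [e] at hd hdet ⊢
  rw [e₁] at h₁ hdet
  rw [e₂] at h₂ hdet
  exact hP.skein hd h₁ h₂ hdet

/-- A rational tangle may be inserted if two vertical strands and two horizontal arcs may, and the
determinants of these have the right signs. -/
theorem plug_tan (hP : SkeinClosed P) (b : Bool) (l : List Op) (C : Context) {σ : ℝ} (hσ : 0 ≤ σ)
    (h : br (C.plug horiz) = sgn b * σ * Complex.I * br (C.plug []))
    (h₁ : P (C.plug [])) (h₂ : P (C.plug horiz)) : P (C.plug (tan b l)) := by
  induction l generalizing C σ with
  | nil => exact hP.plug_cross C hσ h h₁ h₂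
  | cons o l ih =>
    have hc := hP.plug_cross C hσ h h₁ h₂
    have hbr : br (C.plug [cross 0 b]) = vcoeff b * (1 + σ) * br (C.plug []) := by
      rw [evals_cross b C, h, vcoeff_eq]; ring
    have hσ' : (1 + σ : ℂ) ≠ 0 := by exact_mod_cast (by positivity : 1 + σ ≠ 0)
    cases o
    -- The outermost crossing is absorbed into the context. On top of vertical strands it is a
    -- crossing, on top of horizontal arcs a removable curl; the ratio `σ` turns into `σ / (1 + σ)`.
    · have := ih (C.above [cross 0 b] (isTangle_cross_two b)) (σ := σ / (1 + σ)) (by positivity) ?_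
        (by simpa using hc) ?_
      · simpa [tan] using this
      · rw [Context.plug_above, Context.plug_above, List.nil_append, hbr,
          evals_horiz.append (evals_cross b) (isTangle_cross_two b) C, h]
        push_cast
        field_simp
        ring
      · rw [Context.plug_above]
        exact hP.plug_congr C (horiz_append_cross b).symm h₂
    -- At the side the roles are reversed: the crossing untwists beside vertical strands and
    -- survives beside horizontal arcs, and the ratio grows by 1.
    · have := ih (C.side b) (σ := 1 + σ) (by positivity) ?_ ?_ ?_
      · simpa [tan] using this
      · rw [Context.plug_side, Context.plug_side,
          evals_horiz.addSide isTangle_horiz b C, evals_nil.addSide isTangle_nil_two b C, h,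
          vcoeff_eq]
        push_cast
        ring
      · rw [Context.plug_side]
        exact hP.plug_congr C (addSide_nil b).symm h₁
      · rw [Context.plug_side]
        exact hP.plug_congr C (addSide_horiz b).symm hc

end SkeinClosed

/-- A row of crossings. -/
def crossRow (b : Bool) : ℕ → Word
  | 0 => horiz
  | k + 1 => addSide b (crossRow b k)

/-- A column of crossings. -/
def crossColumn (b : Bool) : ℕ → Word
  | 0 => []
  | k + 1 => crossColumn b k ++ [cross 0 b]

theorem isTangle_crossRow (b : Bool) (k : ℕ) : IsTangle (crossRow b k) 2 2 := by
  induction k with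
  | zero => exact isTangle_horiz
  | succ k ih => exact isTangle_addSide ih b

theorem isTangle_crossColumn (b : Bool) (k : ℕ) : IsTangle (crossColumn b k) 2 2 := by
  induction k with
  | zero => exact isTangle_nil_two
  | succ k ih => exact ih.append (isTangle_cross_two b)

theorem hsum_nil_crossRow (b : Bool) (k : ℕ) : TIso 2 2 (hsum [] (crossRow b k)) [] := by
  have hc := isTangle_cross_two b
  have hn := isTangle_nil_two
  induction k with
  | zero => exact hsum_horiz_right hn
  | succ k ih =>
    have hr := isTangle_crossRow b k
    cases b
    · exact (hsum_assoc hn hc hr).symm.trans ((hsum_congr_left (hsum_nil_cross _) hr).trans ih)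
    · exact (hsum_assoc hn hr hc).symm.trans ((hsum_congr_left ih hc).trans (hsum_nil_cross _))

theorem hsum_crossRow_nil (b : Bool) (k : ℕ) : TIso 2 2 (hsum (crossRow b k) []) [] := by
  have hc := isTangle_cross_two b
  have hn := isTangle_nil_two
  induction k with
  | zero => exact hsum_horiz_left hn
  | succ k ih =>
    have hr := isTangle_crossRow b k
    cases b
    · exact (hsum_assoc hc hr hn).trans ((hsum_congr_right ih hc).trans (hsum_cross_nil _))
    · exact (hsum_assoc hr hc hn).trans ((hsum_congr_right (hsum_cross_nil _) hr).trans ih)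

theorem closure_crossColumn (b : Bool) (k : ℕ) :
    TIso 0 0 (closure (crossColumn b k)) (closure []) := by
  induction k with
  | zero => exact .refl _
  | succ k ih => exact (closure_append_cross (isTangle_crossColumn b k) b).trans ih

namespace SkeinClosed

variable {P : Word → Prop}

/-- Here the ratio of the brackets may be infinite, and `plug_tan` does not apply directly.
Crossings added at the side preserve the vanishing and build up a row; the first crossing on top
makes the ratio 1, after which `plug_tan` takes over. -/
theorem plug_tan_of_crossRow (hP : SkeinClosed P)
    (b : Bool) (l : List Op) (C : Context) (h : br (C.plug []) = 0)
    (hk : ∀ k, P (C.plug (crossRow b k))) : P (C.plug (tan b l)) := by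
  have hc : ∀ C : Context, (∀ k, P (C.plug (crossRow b k))) → P (C.plug [cross 0 b]) :=
    fun C hk => hP.plug_congr C (addSide_horiz b) (hk 1)
  induction l generalizing C with
  | nil => exact hc C hk
  | cons o l ih =>
    cases o
    · have := hP.plug_tan b l (C.above [cross 0 b] (isTangle_cross_two b)) (σ := 1) zero_le_one ?_
        (by simpa using hc C hk) ?_
      · simpa [tan] using this
      · rw [Context.plug_above, Context.plug_above, List.nil_append, evals_cross b C,
          evals_horiz.append (evals_cross b) (isTangle_cross_two b) C, h, vcoeff_eq]
        push_cast
        ring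
      · rw [Context.plug_above]
        exact hP.plug_congr C (horiz_append_cross b).symm (hk 0)
    · have := ih (C.side b) ?_ fun k => by simpa [crossRow] using hk (k + 1)
      · simpa [tan] using this
      · rw [Context.plug_side, evals_nil.addSide isTangle_nil_two b C, h]
        ring

/-- The counterpart for ratio 0, where horizontal arcs themselves need not be admissible (their
closure is an unlink). Columns take their place until a crossing at the side makes the ratio 1. -/
theorem plug_tan_of_crossColumn (hP : SkeinClosed P) (b : Bool) (l : List Op) (C : Context)
    (h : br (C.plug horiz) = 0) (hk : ∀ k, P (C.plug (crossColumn b k))) :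
    P (C.plug (tan b l)) := by
  induction l generalizing C with
  | nil => exact hk 1
  | cons o l ih =>
    cases o
    · have := ih (C.above [cross 0 b] (isTangle_cross_two b)) ?_ fun k => by
        simpa [crossColumn] using hk (k + 1)
      · simpa [tan] using this
      · rw [Context.plug_above, evals_horiz.append (evals_cross b) (isTangle_cross_two b) C, h]
        ring
    · have := hP.plug_tan b l (C.side b) (σ := 1) zero_le_one ?_ ?_ ?_
      · simpa [tan] using this
      · rw [Context.plug_side, Context.plug_side,
          evals_horiz.addSide isTangle_horiz b C, evals_nil.addSide isTangle_nil_two b C, h,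
          vcoeff_eq]
        push_cast
        ring
      · rw [Context.plug_side]
        exact hP.plug_congr C (addSide_nil b).symm (hk 0)
      · rw [Context.plug_side]
        exact hP.plug_congr C (addSide_horiz b).symm (hk 1)

/-- A rational tangle beside vertical strands is a two-bridge summand tied into one strand. The
bracket for vertical strands vanishes because of the circle in between, and a row of crossings
simply untwists. -/
theorem plug_hsum_nil_tan (hP : SkeinClosed P)
    (b : Bool) (l : List Op) (C : Context) (h : P (C.plug [])) :
    P (C.plug (hsum [] (tan b l))) := by
  rw [← Context.plug_right C [] isTangle_nil_two]
  refine hP.plug_tan_of_crossRow b l _ (by simpa using br_plug_hsum_nil_nil C) fun k => ?_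
  rw [Context.plug_right]
  exact hP.plug_congr C (hsum_nil_crossRow b k).symm h

theorem plug_hsum_tan_nil (hP : SkeinClosed P)
    (b : Bool) (l : List Op) (C : Context) (h : P (C.plug [])) :
    P (C.plug (hsum (tan b l) [])) := by
  rw [← Context.plug_left C [] isTangle_nil_two]
  refine hP.plug_tan_of_crossRow b l _ (by simpa using br_plug_hsum_nil_nil C) fun k => ?_
  rw [Context.plug_left]
  exact hP.plug_congr C (hsum_crossRow_nil b k).symm h

theorem closure_tan (hP : SkeinClosed P)
    (h : P (closure [])) (b : Bool) (l : List Op) : P (closure (tan b l)) := by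
  rw [← Context.plug_outer]
  refine hP.plug_tan_of_crossColumn b l _ (by simpa using br_closure_horiz) fun k => ?_
  rw [Context.plug_outer]
  exact hP.isotopic (closure_crossColumn b k).symm.isotopic h

end SkeinClosed

/-! ### Rows of tangles -/

/-- The row of the given tangles. -/
def row (A : List Word) : Word := A.foldr hsum horiz

theorem isTangle_foldr {A : List Word} (hA : ∀ T ∈ A, IsTangle T 2 2) {S : Word}
    (hS : IsTangle S 2 2) : IsTangle (A.foldr hsum S) 2 2 := by
  induction A with
  | nil => exact hS
  | cons T A ih =>
    simp only [List.mem_cons, forall_eq_or_imp] at hA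
    exact isTangle_hsum hA.1 (ih hA.2)

theorem isTangle_row {A : List Word} (hA : ∀ T ∈ A, IsTangle T 2 2) : IsTangle (row A) 2 2 :=
  isTangle_foldr hA isTangle_horiz

theorem Context.exists_plug_foldr (C : Context) {A : List Word} (hA : ∀ T ∈ A, IsTangle T 2 2) :
    ∃ C' : Context, ∀ T, C'.plug T = C.plug (A.foldr hsum T) := by
  induction A generalizing C with
  | nil => exact ⟨C, fun _ => rfl⟩
  | cons S A ih =>
    simp only [List.mem_cons, forall_eq_or_imp] at hA
    obtain ⟨C', h⟩ := ih (C.right S hA.1) hA.2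
    exact ⟨C', fun T => by rw [h, Context.plug_right, List.foldr_cons]⟩

/-- The word is a rational tangle. -/
def IsRational (T : Word) : Prop := ∃ b l, T = tan b l

theorem IsRational.isTangle {T : Word} (h : IsRational T) : IsTangle T 2 2 := by
  obtain ⟨b, l, rfl⟩ := h
  exact isTangle_tan b l

namespace SkeinClosed

variable {P : Word → Prop}

theorem plug_hsum_nil_row (hP : SkeinClosed P)
    {B : List Word} (hB : ∀ T ∈ B, IsRational T) (C : Context)
    (h : P (C.plug [])) : P (C.plug (hsum [] (row B))) := by
  induction B generalizing C with
  | nil => exact hP.plug_congr C (hsum_horiz_right isTangle_nil_two).symm h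
  | cons T B ih =>
    simp only [List.mem_cons, forall_eq_or_imp] at hB
    obtain ⟨⟨b, l, rfl⟩, hB⟩ := hB
    have hR : IsTangle (row B) 2 2 := isTangle_row fun T hT => (hB T hT).isTangle
    refine hP.plug_congr C (hsum_assoc isTangle_nil_two (isTangle_tan b l) hR) ?_
    have := hP.plug_hsum_nil_tan b l (C.left (row B) hR) (by simpa using ih hB C h)
    rwa [Context.plug_left] at this

theorem plug_foldr_hsum_nil (hP : SkeinClosed P)
    {A : List Word} (hA : ∀ T ∈ A, IsRational T) {S : Word}
    (hS : IsTangle S 2 2) (C : Context) (h : P (C.plug (hsum [] S))) :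
    P (C.plug (A.foldr hsum (hsum [] S))) := by
  induction A generalizing C with
  | nil => exact h
  | cons T A ih =>
    simp only [List.mem_cons, forall_eq_or_imp] at hA
    obtain ⟨⟨b, l, rfl⟩, hA⟩ := hA
    have := ih hA (C.right (tan b l) (isTangle_tan b l)) ?_
    · simpa using this
    · rw [Context.plug_right]
      refine hP.plug_congr C (hsum_assoc (isTangle_tan b l) isTangle_nil_two hS) ?_
      rw [← Context.plug_left C S hS]
      exact hP.plug_hsum_tan_nil b l _ (by simpa using h)

/-- Connected sums of two-bridge links, drawn as a row of rational tangles and one pair of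
vertical strands. -/
theorem closure_foldr_hsum_nil_row (hP : SkeinClosed P) (h : P (closure [])) {A B : List Word}
    (hA : ∀ T ∈ A, IsRational T) (hB : ∀ T ∈ B, IsRational T) :
    P (closure (A.foldr hsum (hsum [] (row B)))) := by
  rw [← Context.plug_outer]
  refine hP.plug_foldr_hsum_nil hA (isTangle_row fun T hT => (hB T hT).isTangle) _ ?_
  exact hP.plug_hsum_nil_row hB _ (by simpa using h)

/-! ### Two-bridge links -/

/-- The single crossing cancels against the top crossing of its neighbour, leaving vertical strands
beside a rational tangle. -/
theorem closure_hsum_cross_tan_top (hP : SkeinClosed P) (h : P (closure [])) (m : List Op) :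
    P (closure (hsum [cross 0 true] (tan false (.top :: m)))) := by
  have := (closure_hsum_cross_cross isTangle_nil_two (isTangle_tan false m) true).isotopic.symm
  refine hP.isotopic this ?_
  have := hP.plug_hsum_nil_tan false m Context.outer (by simpa using h)
  simpa using this

/-- A Euclidean algorithm on the two slopes: if the last operations agree, the two opposite
crossings cancel and the order of the slopes is kept. A last operation `top` means slope below 1,
`side` above 1, so `slope m < slope l` leaves only a few mixed cases. -/
theorem closure_hsum_tan_tan (hP : SkeinClosed P)
    (h : P (closure [])) (l m : List Op) (hlm : slope m < slope l) :
    P (closure (hsum (tan true l) (tan false m))) := by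
  induction l generalizing m with
  | nil =>
    rcases m with _ | ⟨_ | _, m⟩
    · simp at hlm
    · exact hP.closure_hsum_cross_tan_top h m
    · have := slope_pos m
      simp only [slope] at hlm
      linarith
  | cons o l ih =>
    have hl := slope_pos l
    have hTl := isTangle_tan true l
    cases o
    · have hlt : slope l / (slope l + 1) < 1 := by rw [div_lt_one (by positivity)]; linarith
      rcases m with _ | ⟨_ | _, m⟩
      · simp only [slope] at hlm
        linarith
      · have hm := slope_pos m
        refine hP.isotopic (closure_hsum_cross_cross hTl (isTangle_tan false m)
          true).isotopic.symm (ih m ?_)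
        simp only [slope] at hlm
        rw [div_lt_div_iff₀ (by positivity) (by positivity)] at hlm
        linarith
      · have hm := slope_pos m
        simp only [slope] at hlm
        linarith
    · rcases m with _ | ⟨_ | _, m⟩
      · have s := (hsum_congr_right (T := addSide true (tan true l))
          (hsum_horiz_right (isTangle_cross_two false)) (isTangle_addSide hTl true)).symm.trans
          ((hsum_cross_hsum_cross hTl isTangle_horiz true).trans (hsum_horiz_right hTl))
        have := hP.plug_congr Context.outer s.symm (by simpa using hP.closure_tan h true l)
        rwa [Context.plug_outer] at this
      -- The slopes lie on either side of 1 and nothing cancels. The inner tangle `l` is resolved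
      -- instead. With horizontal arcs in its place the sum is a crossing beside `U`, of slope `1 -
      -- ρ`, which is therefore the ratio `σ`.
      · set U := tan false (.top :: m) with hU
        have hTU : IsTangle U 2 2 := isTangle_tan false _
        have hm := slope_pos m
        obtain ⟨c, hc⟩ := hasSlope_tan false (.top :: m)
        rw [← hU] at hc
        set ρ := slope (.top :: m) with hρ
        have hρ' : ρ ≤ 1 := by
          rw [hρ]; simp only [slope]; rw [div_le_one (by positivity)]; linarith
        have := hP.plug_tan true l ((Context.outer.left U hTU).side true) (σ := 1 - ρ)
          (by linarith) ?_ ?_ ?_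
        · simpa [tan] using this
        · simp only [Context.plug_side, Context.plug_left, Context.plug_outer]
          rw [((evals_horiz.addSide isTangle_horiz true).hsum hc hTU).br_closure,
            ((evals_nil.addSide isTangle_nil_two true).hsum hc hTU).br_closure, vcoeff_eq]
          simp only [sgn]
          push_cast
          simp
          ring
        · rw [Context.plug_side]
          refine hP.plug_congr _ (addSide_nil true).symm ?_
          have := hP.plug_hsum_nil_tan false (.top :: m) Context.outer (by simpa using h)
          simpa using this
        · rw [Context.plug_side]
          refine hP.plug_congr _ (addSide_horiz true).symm ?_
          simpa using hP.closure_hsum_cross_tan_top h m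
      · have := hP.plug_congr Context.outer
          (hsum_cross_hsum_cross hTl (isTangle_tan false m) true).symm (by
          simpa using ih m (by simp only [slope] at hlm; linarith))
        rwa [Context.plug_outer] at this

end SkeinClosed

/-! ### Inserting a rational tangle into a row -/

/-- A dotted diagram of a rational tangle that behaves like `1 / ρ`. -/
structure IsRationalWithSlope (T : Word) (ρ : ℝ) : Prop where
  isTangle : IsTangle T 2 2
  hasSlope : HasSlope T ρ
  isRational : IsRational (eraseDots T)

theorem isRationalWithSlope_tan (b : Bool) (l : List Op) :
    IsRationalWithSlope (tan b l) (sgn b * slope l) where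
  isTangle := isTangle_tan b l
  hasSlope := hasSlope_tan b l
  isRational := ⟨b, l, eraseDots_tan b l⟩

theorem eraseDots_foldr_hsum (A : List Word) (S : Word) :
    eraseDots (A.foldr hsum S) = (A.map eraseDots).foldr hsum (eraseDots S) := by
  induction A with
  | nil => rfl
  | cons T A ih => rw [List.foldr_cons, eraseDots_hsum, ih]; rfl

theorem eraseDots_closure (T : Word) : eraseDots (closure T) = closure (eraseDots T) := by
  simp [closure]

theorem numDots_hsum (T S : Word) : numDots (hsum T S) = numDots T + numDots S := by
  have : numDots (S.map (shift 2)) = numDots S := by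
    simp [numDots, List.countP_map, Function.comp_def]
  simp [hsum, numDots_append, this]

theorem numDots_closure (T : Word) : numDots (closure T) = numDots T := by
  simp [closure, numDots_append]

theorem numDots_foldr_hsum (A : List Word) (S : Word) :
    numDots (A.foldr hsum S) = (A.map numDots).sum + numDots S := by
  induction A with
  | nil => simp
  | cons T A ih => rw [List.foldr_cons, numDots_hsum, ih]; simp [Nat.add_assoc]

theorem numDots_row (A : List Word) : numDots (row A) = (A.map numDots).sum :=
  numDots_foldr_hsum A horiz

theorem numDots_tan (b : Bool) (l : List Op) : numDots (tan b l) = 0 := by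
  rw [← eraseDots_tan, numDots, eraseDots, List.countP_eq_zero]
  simp

theorem hasSlope_row {A : List Word} {ρ : List ℝ} (h : List.Forall₂ IsRationalWithSlope A ρ) :
    HasSlope (row A) ρ.sum ∧ IsTangle (row A) 2 2 := by
  induction h with
  | nil => exact ⟨hasSlope_horiz, isTangle_horiz⟩
  | cons hT _ ih =>
    exact ⟨by rw [List.sum_cons]; exact hT.hasSlope.hsum ih.1 ih.2, isTangle_hsum hT.isTangle ih.2⟩

theorem forall_isRationalWithSlope {A : List Word} {ρ : List ℝ}
    (h : List.Forall₂ IsRationalWithSlope A ρ) :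
    ∀ T ∈ A, IsTangle T 2 2 ∧ IsRational (eraseDots T) := by
  induction h with
  | nil => simp
  | cons hT _ ih =>
    rw [List.forall_mem_cons]
    exact ⟨⟨hT.isTangle, hT.isRational⟩, ih⟩

/-- The tangles of `A` contribute one common factor `d`, whether the rest is a multiple of vertical
strands or has a slope. A common factor is needed to compare the arguments of the two brackets. -/
theorem evals_foldr {A : List Word} {ρ : List ℝ} (h : List.Forall₂ IsRationalWithSlope A ρ) :
    ∃ d : ℂ, ∀ S c, IsTangle S 2 2 →
      (Evals S c 0 → Evals (A.foldr hsum S) (d * c) 0) ∧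
      ∀ τ : ℝ, Evals S (c * Complex.I * τ) c →
        Evals (A.foldr hsum S) (d * c * Complex.I * (ρ.sum + τ)) (d * c) := by
  induction h with
  | nil => exact ⟨1, fun S c _ => by simp⟩
  | @cons T ρ₀ A ρ hT hA ih =>
    obtain ⟨d, hd⟩ := ih
    obtain ⟨e, he⟩ := hT.hasSlope
    have hF : ∀ S, IsTangle S 2 2 → IsTangle (A.foldr hsum S) 2 2 := fun S hS =>
      isTangle_foldr (fun T hT => (forall_isRationalWithSlope hA T hT).1) hS
    refine ⟨e * d, fun S c hS => ⟨fun h => ?_, fun τ h => ?_⟩⟩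
    · have := he.hsum ((hd S c hS).1 h) (hF S hS)
      rw [mul_zero, zero_add, mul_zero, ← mul_assoc] at this
      exact this
    · have := he.hsum ((hd S c hS).2 τ h) (hF S hS)
      rw [show e * d * c * Complex.I * (((ρ₀ :: ρ).sum : ℝ) + τ) =
        e * Complex.I * ρ₀ * (d * c) + e * (d * c * Complex.I * (ρ.sum + τ)) by
          push_cast [List.sum_cons]; ring, mul_assoc e d c]
      exact this

/-- A positive rational tangle is inserted into a row of tangles with nonnegative total slope. -/
theorem IsTQA.insert {A B : List Word} {ρ σ : List ℝ}
    (hA : List.Forall₂ IsRationalWithSlope A ρ) (hB : List.Forall₂ IsRationalWithSlope B σ)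
    (hs : 0 ≤ ρ.sum + σ.sum) (h : IsTQA (closure (row (A ++ B)))) (l : List Op) :
    IsTQA (closure (row (A ++ tan true l :: B))) := by
  obtain ⟨hB₁, hB₂⟩ := hasSlope_row hB
  have hA' := forall_isRationalWithSlope hA
  have hB' := forall_isRationalWithSlope hB
  obtain ⟨C, hC⟩ := Context.outer.exists_plug_foldr fun T hT => (hA' T hT).1
  simp only [Context.plug_outer] at hC
  obtain ⟨d, hd⟩ := evals_foldr hA
  obtain ⟨c, hc⟩ := hB₁
  -- Vertical strands cut the row into a connected sum of two-bridge links. Its dots are inherited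
  -- from the given diagram, so the statement for all markings is used.
  have hnil : IsTQA (closure (A.foldr hsum (hsum [] (row B)))) := by
    have key := skeinClosed_allTQA.closure_foldr_hsum_nil_row (by simpa [closure] using allTQA_unknot)
      (A := A.map eraseDots) (B := B.map eraseDots)
      (by simpa using fun T hT => (hA' T hT).2) (by simpa using fun T hT => (hB' T hT).2)
    refine key _ ?_ ?_ ?_
    · rw [← hC]
      exact C.isDiagram_plug (isTangle_hsum isTangle_nil_two hB₂)
    · have he : eraseDots ∘ eraseDots = eraseDots := funext eraseDots_eraseDots
      simp [eraseDots_closure, eraseDots_foldr_hsum, eraseDots_hsum, row, he]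
    · have := h.isTwoFoldMarked.2
      simpa [numDots_closure, numDots_row, numDots_foldr_hsum, numDots_hsum] using this
  have hhor : IsTQA (closure (A.foldr hsum (hsum horiz (row B)))) := by
    rw [← hC]
    refine skeinClosed_isTQA.plug_congr C (hsum_horiz_left hB₂).symm ?_
    rw [hC]
    simpa [row] using h
  -- The ratio of the two brackets is `i` times the total slope of the row before the insertion.
  have := skeinClosed_isTQA.plug_tan true l (C.left (row B) hB₂) (σ := ρ.sum + σ.sum) hs ?_
    (by simpa [hC] using hnil) (by simpa [hC] using hhor)
  · simpa [hC, row] using this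
  · simp only [Context.plug_left, hC]
    have h₁ := evals_nil.hsum hc hB₂
    have h₂ := evals_horiz.hsum hc hB₂
    rw [zero_mul, zero_mul, add_zero, one_mul] at h₁
    rw [zero_mul, zero_add, one_mul, one_mul] at h₂
    rw [((hd _ c (isTangle_hsum isTangle_nil_two hB₂)).1 h₁).br_closure,
      ((hd _ c (isTangle_hsum isTangle_horiz hB₂)).2 _ h₂).br_closure]
    simp only [sgn, if_true]
    push_cast
    ring

/-- Starting from the two tangles `T` and `U`, positive tangles are inserted first between them and
then to the left. Positive slopes keep the total nonnegative throughout. -/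
theorem IsTQA.insert_lists {A B : List (List Op)} {T U : Word} {ρ σ : ℝ}
    (hT : IsRationalWithSlope T ρ) (hU : IsRationalWithSlope U σ) (hs : 0 ≤ ρ + σ)
    (h : IsTQA (closure (row [T, U]))) :
    IsTQA (closure (row (A.map (tan true) ++ T :: (B.map (tan true) ++ [U])))) := by
  have hpos : ∀ B : List (List Op), 0 ≤ (B.map slope).sum := fun B =>
    List.sum_nonneg (by simpa using fun l _ => (slope_pos l).le)
  have hslope : ∀ B : List (List Op),
      List.Forall₂ IsRationalWithSlope (B.map (tan true)) (B.map slope) := fun B => by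
    induction B with
    | nil => exact .nil
    | cons l B ih => exact .cons (by simpa [sgn] using isRationalWithSlope_tan true l) ih
  have hBU : ∀ B : List (List Op), List.Forall₂ IsRationalWithSlope (B.map (tan true) ++ [U])
      (B.map slope ++ [σ]) := fun B =>
    List.rel_append (hslope B) (.cons hU .nil)
  induction A with
  | nil =>
    induction B with
    | nil => exact h
    | cons l B ih =>
      refine IsTQA.insert (A := [T]) (ρ := [ρ]) (.cons hT .nil) (hBU B) ?_ ih l
      have := hpos B
      simp only [List.sum_append, List.sum_singleton]
      linarith
  | cons l A ih =>
    refine IsTQA.insert (A := []) .nil (List.rel_append (hslope A) (.cons hT (hBU B))) ?_ ih l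
    have := hpos A
    have := hpos B
    simp only [List.sum_append, List.sum_cons, List.sum_nil]
    linarith

/-! ### The split unlink -/

/-- The link formed by a rational tangle and its mirror image is the unlink of two components; with
an odd number of dots on each component it is TQA. -/
theorem exists_dots_isTQA (l : List Op) :
    -- One dot stays at the lower left end. The other one is pushed along its strand whenever a
    -- crossing is added, and visits only the three remaining ends of the tangle.
    ∃ d d', (d = [dot 0, dot 1] ∧ d' = [] ∨ d = [dot 0] ∧ d' = [dot 0] ∨
      d = [dot 0] ∧ d' = [dot 1]) ∧
      IsTQA (closure (hsum (d ++ tan true l ++ d') (tan false l))) := by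
  have hT := isTangle_tan true
  have hU := isTangle_tan false
  have hc := isTangle_cross_two true
  have h0 : IsTangle [dot 0] 2 2 := by simp
  have h1 : IsTangle [dot 1] 2 2 := by simp
  have h01 : IsTangle [dot 0, dot 1] 2 2 := by simp
  induction l with
  | nil =>
    refine ⟨[dot 0, dot 1], [], by simp, ?_⟩
    have hodd : IsOddMarked [cup 0, dot 0, cap 0] := ⟨by simp [IsDiagram], by simp⟩
    refine .isotopic _ _ (.split _ _ hodd hodd) (TIso.isotopic ?_)
    have := closure_hsum_cross_cross h01 isTangle_nil_two true
    exact (this.trans nested_circles).symm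
  | cons o l ih =>
    obtain ⟨d, d', hdd, ih⟩ := ih
    -- The new crossings of the tangle and of its mirror image cancel, so only the positions of the
    -- dots relative to the new crossing have to be followed.
    have hTU : ∀ S, TIso 2 2 (addSide true (d ++ tan true l ++ d')) S →
        IsTangle (d ++ tan true l ++ d') 2 2 → IsTQA (closure (hsum S (tan false (.side :: l)))) := by
      intro S hS ht
      have := skeinClosed_isTQA.plug_congr Context.outer
        ((hsum_cross_hsum_cross ht (hU l) true).symm.trans
          (hsum_congr_left hS (hU (.side :: l)))) (by simpa using ih)
      rwa [Context.plug_outer] at this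
    have hTU' : ∀ S, TIso 2 2 (d ++ tan true l ++ d' ++ [cross 0 true]) S →
        IsTangle (d ++ tan true l ++ d') 2 2 → IsTQA (closure (hsum S (tan false (.top :: l)))) := by
      intro S hS ht
      have := skeinClosed_isTQA.plug_congr Context.outer (hsum_congr_left hS (hU (.top :: l)))
        (by
          rw [Context.plug_outer]
          exact .isotopic _ _ ih (closure_hsum_cross_cross ht (hU l) true).symm.isotopic)
      simpa using this
    cases o
    · obtain ⟨rfl, rfl⟩ | ⟨rfl, rfl⟩ | ⟨rfl, rfl⟩ := hdd
      · refine ⟨[dot 0, dot 1], [], by simp, hTU' _ (.of_eq (by simp [tan])) ?_⟩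
        exact (h01.append (hT l)).append isTangle_nil_two
      · refine ⟨[dot 0], [dot 1], by simp, hTU' _ ?_ ((h0.append (hT l)).append h0)⟩
        simpa [tan] using (cross_dot_one true).symm.append_left (h0.append (hT l))
      · refine ⟨[dot 0], [dot 0], by simp, hTU' _ ?_ ((h0.append (hT l)).append h1)⟩
        simpa [tan] using (cross_dot_zero true).symm.append_left (h0.append (hT l))
    · obtain ⟨rfl, rfl⟩ | ⟨rfl, rfl⟩ | ⟨rfl, rfl⟩ := hdd
      · refine ⟨[dot 0], [dot 1], by simp, hTU _ ?_ ((h01.append (hT l)).append isTangle_nil_two)⟩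
        have s := (dot_zero_hsum (h1.append (hT l)) hc).symm.trans
          ((hsum_cross_dot_one (hT l) true).symm.append_left h0)
        simpa [tan, addSide] using s
      · refine ⟨[dot 0], [dot 0], by simp, hTU _ ?_ ((h0.append (hT l)).append h0)⟩
        have s := (dot_zero_hsum ((hT l).append h0) hc).symm.trans
          ((hsum_dot_zero (hT l) hc).symm.append_left h0)
        simpa [tan, addSide] using s
      · refine ⟨[dot 0, dot 1], [], by simp, hTU _ ?_ ((h0.append (hT l)).append h1)⟩
        have s := (dot_zero_hsum ((hT l).append h1) hc).symm.trans
          ((dot_one_hsum_cross (hT l) true).symm.append_left h0)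
        simpa [tan, addSide] using s

/-! ### Montesinos links -/

/-- The subtractive Euclidean algorithm: subtracting from the numerator is a crossing on top, from
the denominator a crossing at the side. The same list `l` serves both signs, so opposite tangles are
mirror images crossing by crossing. -/
theorem exists_rationalTangleAux_eq {a b : ℕ} (ha : 0 < a) (hb : 0 < b) (hab : a.Coprime b) :
    ∃ l, (∀ s, rationalTangleAux s a b = tan s l) ∧ slope l = b / a := by
  induction hn : a + b using Nat.strong_induction_on generalizing a b with
  | _ n ih =>
    subst hn
    rcases lt_trichotomy b a with h | rfl | h
    · obtain ⟨l, h₁, h₂⟩ := ih (a - b + b) (by omega) (a := a - b) (by omega) hb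
        ((Nat.coprime_sub_self_left h.le).2 hab) rfl
      refine ⟨.top :: l, fun s => ?_, ?_⟩
      · rw [rationalTangleAux, if_neg (by omega), if_pos h.le, h₁, tan]
      · have hb' : (0 : ℝ) < b := by exact_mod_cast hb
        have hab' : (0 : ℝ) < a - b := by
          rw [sub_pos]; exact_mod_cast h
        have ha' : (0 : ℝ) < a := by exact_mod_cast ha
        rw [slope, h₂, Nat.cast_sub h.le]
        field_simp
        ring
    · obtain rfl : b = 1 := by simpa using hab
      refine ⟨[], fun s => ?_, by simp [slope]⟩
      rw [rationalTangleAux, rationalTangleAux]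
      simp [tan]
    · obtain ⟨l, h₁, h₂⟩ := ih (a + (b - a)) (by omega) (b := b - a) ha (by omega)
        ((Nat.coprime_sub_self_right h.le).2 hab) rfl
      refine ⟨.side :: l, fun s => ?_, ?_⟩
      · rw [rationalTangleAux, if_neg (by omega), if_neg (by omega), tan, addSide]
        cases s <;> simp [h₁]
      · have ha' : (0 : ℝ) < a := by exact_mod_cast ha
        rw [slope, h₂, Nat.cast_sub h.le]
        field_simp
        ring

theorem exists_rationalTangle_eq {t : ℚ} (ht : 0 < t) :
    ∃ l, rationalTangle t = tan true l ∧ rationalTangle (-t) = tan false l ∧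
      slope l = (t : ℝ)⁻¹ := by
  have hnum : 0 < t.num := Rat.num_pos.2 ht
  obtain ⟨l, h₁, h₂⟩ := exists_rationalTangleAux_eq (a := t.num.natAbs) (b := t.den) (by omega)
    t.den_pos t.reduced
  refine ⟨l, ?_, ?_, ?_⟩
  · simp [rationalTangle, ht.le, h₁]
  · simp [rationalTangle, not_le.2 ht, h₁]
  · rw [h₂, show (t : ℝ) = (t.num.natAbs : ℝ) / t.den by
      have := Rat.cast_def (K := ℝ) t
      rw [this]
      congr 1
      rw [← Int.cast_natCast, Int.natAbs_of_nonneg hnum.le], inv_div]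

theorem montesinos_zero (t : List ℚ) : montesinos 0 t = closure (row (t.map rationalTangle)) := by
  simp [montesinos, halfTwists, closure, row]

theorem exists_isTQA_montesinos {n : ℕ} (r : Fin n → ℚ) (s : ℚ) (hr : ∀ i, 0 < r i) (hs : 0 < s)
    (i : Fin n) (hi : r i ≤ s) :
    ∃ D, IsTQA D ∧ eraseDots D = montesinos 0 (List.ofFn r ++ [-s]) := by
  obtain ⟨A, B, hAB⟩ := List.append_of_mem ((List.mem_ofFn' r _).2 ⟨i, rfl⟩)
  have hpos : ∀ x ∈ A ++ r i :: B, 0 < x := by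
    rw [← hAB]; simpa using hr
  have lists : ∀ A : List ℚ, (∀ x ∈ A, 0 < x) → ∃ A' : List (List Op),
      A.map rationalTangle = A'.map (tan true) := by
    intro A hA
    induction A with
    | nil => exact ⟨[], rfl⟩
    | cons x A ih =>
      obtain ⟨A', hA'⟩ := ih fun y hy => hA y (by simp [hy])
      obtain ⟨l, hl, -, -⟩ := exists_rationalTangle_eq (hA x (by simp))
      exact ⟨l :: A', by simp [hl, hA']⟩
  obtain ⟨A', hA'⟩ := lists A fun x hx => hpos x (by simp [hx])
  obtain ⟨B', hB'⟩ := lists B fun x hx => hpos x (by simp [hx])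
  obtain ⟨l, hl, hlm, hl'⟩ := exists_rationalTangle_eq (hr i)
  obtain ⟨m, -, hm, hm'⟩ := exists_rationalTangle_eq hs
  -- It is enough to treat the link formed by `rᵢ` and `-s`, with dots placed on the tangle `rᵢ`
  -- only: its slope `1/rᵢ - 1/s` is nonnegative, and all other tangles can be inserted.
  suffices ∃ T, IsTangle T 2 2 ∧ eraseDots T = tan true l ∧ IsTQA (closure (hsum T (tan false m))) by
    obtain ⟨T, hT, hTe, hTQA⟩ := this
    obtain ⟨c, hc⟩ := hasSlope_tan true l
    have hTs : IsRationalWithSlope T (sgn true * slope l) :=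
      ⟨hT, ⟨c, .of_eraseDots hT (by rwa [hTe])⟩, ⟨true, l, hTe⟩⟩
    refine ⟨_, IsTQA.insert_lists (A := A') (B := B') hTs (isRationalWithSlope_tan false m) ?_ ?_, ?_⟩
    · have h₁ : (0 : ℝ) < r i := by exact_mod_cast hr i
      have h₂ : (r i : ℝ) ≤ s := by exact_mod_cast hi
      have := inv_anti₀ h₁ h₂
      simp only [sgn, if_true, hl', hm', Bool.false_eq_true, if_false]
      linarith
    · have := skeinClosed_isTQA.plug_congr Context.outer
        (hsum_congr_right (hsum_horiz_right (isTangle_tan false m)).symm hT) (by simpa using hTQA)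
      simpa [row] using this
    · have he : eraseDots ∘ tan true = tan true := funext (eraseDots_tan true)
      rw [montesinos_zero, hAB, eraseDots_closure, row, eraseDots_foldr_hsum]
      simp [row, hA', hB', hl, hm, hTe, he, eraseDots_tan]
  rcases hi.lt_or_eq with h | h
  · refine ⟨tan true l, isTangle_tan true l, eraseDots_tan true l, ?_⟩
    refine skeinClosed_allTQA.closure_hsum_tan_tan (by simpa [closure] using allTQA_unknot) l m ?_ _
      ?_ rfl ?_
    · rw [hl', hm']
      exact inv_strictAnti₀ (by exact_mod_cast hr i) (by exact_mod_cast h)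
    · rw [← Context.plug_outer]
      exact Context.isDiagram_plug _ (isTangle_hsum (isTangle_tan true l) (isTangle_tan false m))
    · simp [numDots_closure, numDots_hsum, numDots_tan]
  -- For `rᵢ = s` the determinant is 0, and a nontrivial marking of the split unlink is what starts
  -- the induction.
  · obtain ⟨d, d', hdd, hTQA⟩ := exists_dots_isTQA l
    rw [h, hm] at hlm
    rw [← hlm] at hTQA
    refine ⟨_, ?_, ?_, hTQA⟩
    · have hT := isTangle_tan true l
      obtain ⟨rfl, rfl⟩ | ⟨rfl, rfl⟩ | ⟨rfl, rfl⟩ := hdd <;>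
        exact (IsTangle.append (by simp) hT).append (by simp)
    · obtain ⟨rfl, rfl⟩ | ⟨rfl, rfl⟩ | ⟨rfl, rfl⟩ := hdd <;> simp [eraseDots_tan]

end MarkedLinks

theorem proposition6p2 {n : ℕ} [NeZero n] (r : Fin n → ℚ) (s : ℚ)
    (hr : ∀ i, 0 < r i) (hs : 0 < s)
    (hmin : Finset.univ.inf' Finset.univ_nonempty r ≤ s) :
    (∃ D : MarkedLinks.Word,
      MarkedLinks.IsTwoFoldMarked D ∧
      MarkedLinks.eraseDots D = MarkedLinks.montesinos 0 (List.ofFn r ++ [-s]) ∧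
      MarkedLinks.IsTQA D) ∧
    (MarkedLinks.IsKnot (MarkedLinks.montesinos 0 (List.ofFn r ++ [-s])) →
      MarkedLinks.IsTQA (MarkedLinks.montesinos 0 (List.ofFn r ++ [-s]))) := by
  obtain ⟨i, -, hi⟩ := Finset.exists_mem_eq_inf' Finset.univ_nonempty r
  obtain ⟨D, hD, hDe⟩ := MarkedLinks.exists_isTQA_montesinos r s hr hs i (hi ▸ hmin)
  obtain ⟨hD₁, hD₂⟩ := hD.isTwoFoldMarked
  refine ⟨⟨D, ⟨hD₁, hD₂⟩, hDe, hD⟩, fun hK => ?_⟩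
  rw [← hDe] at hK ⊢
  -- A knot has only the trivial marking: the dots of `D`, even in number, cancel.
  have hc : MarkedLinks.numComponents D = 1 := by
    rw [← MarkedLinks.numComponents_eraseDots hD₁, hK.2]
  exact .isotopic _ _ hD (MarkedLinks.isotopic_eraseDots hD₁ hc hD₂)
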